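/- Let $E=(E^0,E^1,r,s)$ be a directed graph with countable vertex and edge sets that is locally finite (each vertex emits and receives at most finitely many edges) and has no sources (each vertex receives an edge). Let $E^*$ be the set of finite paths in $E$, with vertices as the paths of length $0$; write $|\mu|$, $r(\mu)$ for the length and range of a path $\mu$, and $|v|_k$ for the number of paths of length $k$ with range $v$. Let $A=C^*(E)$ be the graph $C^*$-algebra, universal for Cuntz–Krieger families $\{p_v,S_e\}$ ($p_v$ mutually orthogonal projections, $S_e$ partial isometries, $S_e^*S_e=p_{r(e)}$, and $p_v=\sum_{s(e)=v}S_eS_e^*$ whenever $v$ emits an edge); put $S_\mu=S_{\mu_1}\cdots S_{\mu_n}$ for a path $\mu=\mu_1\cdots\mu_n$ and $S_v=p_v$ for a vertex $v$. Let $\gamma$ be the gauge action of the circle on $A$ ($\gamma_z(S_e)=zS_e$, $\gamma_z(p_v)=p_v$), $F$ its fixed point algebra, $\Phi(a)=\frac1{2\pi}\int_0^{2\pi}\gamma_{e^{i\theta}}(a)\,d\theta$ the expectation of $A$ onto $F$, and $X_c=A_c=\operatorname{span}\{S_\mu S_\nu^*:\mu,\nu\in E^*,\ r(\mu)=r(\nu)\}$.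 Let $\tau:A_+\to[0,\infty]$ be a faithful, semifinite (that is, $\{a\in A_+:\tau(a)<\infty\}$ is norm dense in $A_+$), norm lower-semicontinuous, gauge invariant trace; it is finite on $A_c$, in the sense that $A_c\subset\operatorname{span}\{a\in A_+:\tau(a)<\infty\}$, and $\tau$ also denotes its linear extension to this span. Let $\mathcal H=L^2(X,\tau)$ be the completion of $X_c$ in the inner product $\langle x,y\rangle=\tau(x^*y)$. For $x,y\in X_c$ let $\Theta_{x,y}$ be the bounded operator on $\mathcal H$ with $\Theta_{x,y}z=x\,\Phi(y^*z)$ for $z\in X_c$, let $End^{00}_F(X_c)$ be the linear span of all $\Theta_{x,y}$, $x,y\in X_c$, and let $\mathcal N=(End^{00}_F(X_c))''\subset\mathcal B(\mathcal H)$. For $T\in\mathcal N$ and $\mu\in E^*$ put $$\omega_\mu(T)=\langle S_\mu,TS_\mu\rangle+\frac1{|r(\mu)|_{|\mu|}}\langle S_\mu^*,TS_\mu^*\rangle\ \text{ if }|\mu|\ne0,\qquad \omega_v(T)=\langle p_v,Tp_v\rangle\ \text{ for } v\in E^0,$$ and define $\tilde\tau:\mathcal N_+\to[0,\infty]$ by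 $\tilde\tau(T)=\sum_{\mu\in E^*}\omega_\mu(T)$, the limit of the sums over finite subsets of $E^*$. Then $\tilde\tau$ is a faithful normal semifinite trace on $\mathcal N$. Moreover $$End^{00}_F(X_c)\subset\mathcal N_{\tilde\tau}:=\operatorname{span}\{T\in\mathcal N_+:\tilde\tau(T)<\infty\},$$ and the linear extension of $\tilde\tau$ to $\mathcal N_{\tilde\tau}$ satisfies $$\tilde\tau(\Theta_{x,y})=\langle y,x\rangle=\tau(y^*x)\qquad\text{for all } x,y\in X_c.$$ -/

import Mathlib

open scoped ENNReal NNReal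

noncomputable section

set_option linter.unusedSectionVars false
set_option linter.unnecessarySeqFocus false

universe u v

/-- A directed graph with vertex set `V`, edge set `E`, range map `rng` and source map `src`, that is
row-finite: each vertex emits at most finitely many edges. -/
structure RowFiniteGraph (V : Type u) (E : Type v) where
  rng : E → V
  src : E → V
  row_finite : ∀ v, {e | src e = v}.Finite

namespace RowFiniteGraph

variable {V : Type u} {E : Type v}

/-- Each vertex receives at most finitely many edges (and the graph is row-finite). -/
def LocallyFinite (G : RowFiniteGraph V E) : Prop :=
  ∀ v, {e | G.rng e = v}.Finite

/-- Each vertex receives at least one edge. -/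
def NoSources (G : RowFiniteGraph V E) : Prop :=
  ∀ v, ∃ e, G.rng e = v

/-! ### Paths -/

/-- `IsPathFrom v [μ₁, …, μₙ]`: `μ₁ ⋯ μₙ` is a path with source `v`. -/
def IsPathFrom (G : RowFiniteGraph V E) : V → List E → Prop
  | _, [] => True
  | v, e :: l => G.src e = v ∧ G.IsPathFrom (G.rng e) l

/-- The range of the path with source `v` and list of edges `l`. -/
def rangeFrom (G : RowFiniteGraph V E) : V → List E → V
  | v, [] => v
  | _, e :: l => G.rangeFrom (G.rng e) l

/-- The set `E^*` of finite paths. Vertices are the paths of length zero. -/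
structure FinPath (G : RowFiniteGraph V E) where
  source : V
  edges : List E
  isPath : G.IsPathFrom source edges

namespace FinPath

variable {G : RowFiniteGraph V E}

/-- The length `|μ|`. -/
def length (μ : G.FinPath) : ℕ := μ.edges.length

/-- The range `r(μ)`. -/
def range (μ : G.FinPath) : V := G.rangeFrom μ.source μ.edges

end FinPath

/-- `|v|_k`, the number of paths of length `k` with range `v`. -/
noncomputable def numPaths (G : RowFiniteGraph V E) (v : V) (k : ℕ) : ℕ :=
  Nat.card {μ : G.FinPath // μ.length = k ∧ μ.range = v}

/-! ### Cuntz–Krieger families and the graph algebra -/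

/-- A Cuntz–Krieger `G`-family in a C⋆-algebra `B`. -/
structure CKFamily (G : RowFiniteGraph V E) (B : Type*) [NonUnitalCStarAlgebra B] where
  p : V → B
  S : E → B
  isStarProjection_p : ∀ v, IsStarProjection (p v)
  p_mul_p : ∀ v w, v ≠ w → p v * p w = 0
  isPartialIsometry : ∀ e, S e * star (S e) * S e = S e
  star_S_mul_S : ∀ e, star (S e) * S e = p (G.rng e)
  p_eq_sum : ∀ v, (∃ e, G.src e = v) →
    p v = ∑ e ∈ (G.row_finite v).toFinset, S e * star (S e)

/-- A C⋆-algebra together with a Cuntz–Krieger `G`-family in it. (A C⋆-algebra generated by such a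
family is separable for a countable graph, hence it has a copy in `Type`.) -/
structure CKRep (G : RowFiniteGraph V E) where
  B : Type
  [cstar : NonUnitalCStarAlgebra B]
  fam : G.CKFamily B

attribute [instance] CKRep.cstar

lemma CKFamily.norm_p_le {G : RowFiniteGraph V E} {B : Type*} [NonUnitalCStarAlgebra B]
    (f : G.CKFamily B) (v : V) : ‖f.p v‖ ≤ 1 := by
  have h := CStarRing.norm_star_mul_self (x := f.p v)
  rw [(f.isStarProjection_p v).isSelfAdjoint.star_eq,
    (f.isStarProjection_p v).isIdempotentElem.eq] at h
  nlinarith [norm_nonneg (f.p v)]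

lemma CKFamily.norm_S_le {G : RowFiniteGraph V E} {B : Type*} [NonUnitalCStarAlgebra B]
    (f : G.CKFamily B) (e : E) : ‖f.S e‖ ≤ 1 := by
  have h := CStarRing.norm_star_mul_self (x := f.S e)
  rw [f.star_S_mul_S] at h
  nlinarith [norm_nonneg (f.S e), f.norm_p_le (G.rng e)]

/-- The C⋆-algebra of bounded families indexed by all Cuntz–Krieger families. -/
abbrev BoundedFamilies (G : RowFiniteGraph V E) : Type _ := lp (fun i : G.CKRep => i.B) ∞

/-- The family of all `p_v`. -/
def univP (G : RowFiniteGraph V E) (v : V) : G.BoundedFamilies :=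
  ⟨fun i => i.fam.p v, memℓp_infty ⟨1, by rintro _ ⟨i, rfl⟩; exact i.fam.norm_p_le v⟩⟩

/-- The family of all `S_e`. -/
def univS (G : RowFiniteGraph V E) (e : E) : G.BoundedFamilies :=
  ⟨fun i => i.fam.S e, memℓp_infty ⟨1, by rintro _ ⟨i, rfl⟩; exact i.fam.norm_S_le e⟩⟩

/-- The algebraic ⋆-algebra generated by the universal family. -/
def algPart (G : RowFiniteGraph V E) : NonUnitalStarSubalgebra ℂ G.BoundedFamilies :=
  NonUnitalStarAlgebra.adjoin ℂ (Set.range G.univP ∪ Set.range G.univS)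

/-- The universal C⋆-algebra `C^*(G)` generated by a Cuntz–Krieger `G`-family, realised as the
C⋆-algebra generated by the direct sum of all Cuntz–Krieger `G`-families. -/
def CStar (G : RowFiniteGraph V E) : Type _ := G.algPart.topologicalClosure

noncomputable instance (G : RowFiniteGraph V E) : NonUnitalCStarAlgebra G.CStar :=
  NonUnitalStarSubalgebra.nonUnitalCStarAlgebra G.algPart.topologicalClosure
    (h_closed := G.algPart.isClosed_topologicalClosure)

/-- The usual order: `0 ≤ a` iff `a` is selfadjoint with nonnegative spectrum. -/
noncomputable instance (G : RowFiniteGraph V E) : PartialOrder G.CStar :=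
  CStarAlgebra.spectralOrder _

instance (G : RowFiniteGraph V E) : StarOrderedRing G.CStar :=
  CStarAlgebra.spectralOrderedRing _

namespace CStar

variable (G : RowFiniteGraph V E)

/-- The inclusion into the bounded families. -/
def incl : G.CStar →⋆ₙₐ[ℂ] G.BoundedFamilies where
  toFun x := x.1
  map_smul' _ _ := rfl
  map_zero' := rfl
  map_add' _ _ := rfl
  map_mul' _ _ := rfl
  map_star' _ := rfl

variable {G} in
@[ext] lemma ext {a b : G.CStar} (h : ∀ i : G.CKRep, (incl G a).1 i = (incl G b).1 i) : a = b :=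
  Subtype.ext (Subtype.ext (funext h))

/-- The generating projection `p_v`. -/
def p (v : V) : G.CStar :=
  ⟨G.univP v, G.algPart.le_topologicalClosure
    (NonUnitalStarAlgebra.subset_adjoin _ _ (Or.inl ⟨v, rfl⟩))⟩

/-- The generating partial isometry `S_e`. -/
def S (e : E) : G.CStar :=
  ⟨G.univS e, G.algPart.le_topologicalClosure
    (NonUnitalStarAlgebra.subset_adjoin _ _ (Or.inr ⟨e, rfl⟩))⟩

/-- Evaluation at a Cuntz–Krieger family. -/
def eval (i : G.CKRep) : G.CStar →⋆ₙₐ[ℂ] i.B where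
  toFun x := (incl G x).1 i
  map_smul' _ _ := rfl
  map_zero' := rfl
  map_add' _ _ := rfl
  map_mul' _ _ := rfl
  map_star' _ := rfl

/-- The universal Cuntz–Krieger family. -/
def family : G.CKFamily G.CStar where
  p := p G
  S := S G
  isStarProjection_p v := ⟨ext fun i => (i.fam.isStarProjection_p v).isIdempotentElem,
    ext fun i => (i.fam.isStarProjection_p v).isSelfAdjoint⟩
  p_mul_p v w h := ext fun i => i.fam.p_mul_p v w h
  isPartialIsometry e := ext fun i => i.fam.isPartialIsometry e
  star_S_mul_S e := ext fun i => i.fam.star_S_mul_S e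
  p_eq_sum v h := ext fun i => by
    have h2 : eval G i (p G v) =
        eval G i (∑ e ∈ (G.row_finite v).toFinset, S G e * star (S G e)) := by
      rw [map_sum]
      exact i.fam.p_eq_sum v h
    exact h2

/-- The universal property of `C^*(G)`. -/
theorem exists_lift (B : Type) [NonUnitalCStarAlgebra B] (f : G.CKFamily B) :
    ∃ φ : G.CStar →⋆ₙₐ[ℂ] B, (∀ v, φ (p G v) = f.p v) ∧ ∀ e, φ (S G e) = f.S e :=
  ⟨eval G ⟨B, f⟩, fun _ => rfl, fun _ => rfl⟩

/-! ### The gauge action -/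

/-- The Cuntz–Krieger family `{z S_e, p_v}`. -/
def _root_.RowFiniteGraph.CKRep.rotate {G : RowFiniteGraph V E} (z : Circle) (i : G.CKRep) :
    G.CKRep where
  B := i.B
  fam :=
    { p := i.fam.p
      S := fun e => (z : ℂ) • i.fam.S e
      isStarProjection_p := i.fam.isStarProjection_p
      p_mul_p := i.fam.p_mul_p
      isPartialIsometry := fun e => by
        have hz : (z : ℂ) * (star (z : ℂ) * (z : ℂ)) = z := by
          simp [Complex.conj_mul', Circle.norm_coe]
        simp only [star_smul, smul_mul_assoc, mul_smul_comm, smul_smul, i.fam.isPartialIsometry]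
        rw [show (z : ℂ) * (star (z : ℂ) * (z : ℂ)) = z from hz]
      star_S_mul_S := fun e => by
        have hz : (star (z : ℂ) * (z : ℂ)) = 1 := by
          simp [Complex.conj_mul', Circle.norm_coe]
        simp only [star_smul, smul_mul_assoc, mul_smul_comm, smul_smul, i.fam.star_S_mul_S]
        rw [mul_comm, hz, one_smul]
      p_eq_sum := fun v h => by
        have hz : ((z : ℂ) * star (z : ℂ)) = 1 := by
          simp [Complex.mul_conj', Circle.norm_coe]
        rw [i.fam.p_eq_sum v h]
        refine Finset.sum_congr rfl fun e _ => ?_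
        simp only [star_smul, smul_mul_assoc, mul_smul_comm, smul_smul]
        rw [mul_comm, hz, one_smul] }

/-- Reindexing the bounded families along `{S_e, p_v} ↦ {z S_e, p_v}`. -/
def rotateFamilies (z : Circle) : G.BoundedFamilies →⋆ₙₐ[ℂ] G.BoundedFamilies where
  toFun x := ⟨fun i => x.1 (i.rotate z), by
    obtain ⟨C, hC⟩ := memℓp_infty_iff.1 x.2
    exact memℓp_infty ⟨C, by rintro _ ⟨i, rfl⟩; exact hC ⟨i.rotate z, rfl⟩⟩⟩
  map_smul' _ _ := rfl
  map_zero' := rfl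
  map_add' _ _ := rfl
  map_mul' _ _ := rfl
  map_star' _ := rfl

lemma rotateFamilies_mem (z : Circle) (x : G.BoundedFamilies)
    (hx : x ∈ G.algPart.topologicalClosure) :
    rotateFamilies G z x ∈ G.algPart.topologicalClosure := by
  have hc : Continuous (rotateFamilies G z) := by
    refine AddMonoidHomClass.continuous_of_bound (rotateFamilies G z) 1 fun x => ?_
    rw [one_mul]
    exact NonUnitalStarAlgHom.norm_apply_le _ x
  have h1 : G.algPart.map (rotateFamilies G z) ≤ G.algPart := by
    rw [algPart, NonUnitalStarAlgHom.map_adjoin]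
    refine NonUnitalStarAlgebra.adjoin_le ?_
    rintro _ ⟨_, ⟨v, rfl⟩ | ⟨e, rfl⟩, rfl⟩
    · exact NonUnitalStarAlgebra.subset_adjoin _ _ (Or.inl ⟨v, rfl⟩)
    · have : rotateFamilies G z (G.univS e) = (z : ℂ) • G.univS e := rfl
      rw [this]
      exact SMulMemClass.smul_mem _
        (NonUnitalStarAlgebra.subset_adjoin _ _ (Or.inr ⟨e, rfl⟩))
  have h2 := NonUnitalStarSubalgebra.map_topologicalClosure_le (s := G.algPart) hc
  exact NonUnitalStarSubalgebra.topologicalClosure_mono h1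
    (h2 ⟨x, hx, rfl⟩)

/-- The gauge action: `γ_z (S_e) = z S_e` and `γ_z (p_v) = p_v`. -/
def gauge (z : Circle) : G.CStar →⋆ₙₐ[ℂ] G.CStar where
  toFun x := ⟨rotateFamilies G z x.1, rotateFamilies_mem G z x.1 x.2⟩
  map_smul' _ _ := rfl
  map_zero' := rfl
  map_add' _ _ := rfl
  map_mul' _ _ := rfl
  map_star' _ := rfl

lemma gauge_p (z : Circle) (v : V) : gauge G z (p G v) = p G v := rfl

lemma gauge_S (z : Circle) (e : E) : gauge G z (S G e) = (z : ℂ) • S G e := rfl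

/-- The expectation `Φ(a) = (1/2π) ∫ γ_z(a) dθ`, `z = e^{iθ}`. -/
noncomputable def expect (a : G.CStar) : G.CStar :=
  (2 * Real.pi)⁻¹ • ∫ θ in (0 : ℝ)..(2 * Real.pi), gauge G (Circle.exp θ) a

end CStar
end RowFiniteGraph

/-! ### Traces -/

/-- The positive cone of an ordered vector space. -/
abbrev PosCone (A : Type*) [Zero A] [LE A] : Type _ := {a : A // 0 ≤ a}

section Trace

variable {A : Type*} [NonUnitalRing A] [StarRing A] [Module ℂ A] [PartialOrder A]

/-- `φ : A₊ → [0, ∞]` is a trace: it is additive, positively homogeneous (with `0 · ∞ = 0`), and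
`φ(x^* x) = φ(x x^*)`. -/
structure IsTrace (φ : PosCone A → ℝ≥0∞) : Prop where
  additive : ∀ a b c : PosCone A, (c : A) = a + b → φ c = φ a + φ b
  homogeneous : ∀ (r : ℝ≥0) (a c : PosCone A), (c : A) = ((r : ℝ) : ℂ) • (a : A) → φ c = r * φ a
  tracial : ∀ (x : A) (a b : PosCone A), (a : A) = star x * x → (b : A) = x * star x → φ a = φ b

/-- `φ` is faithful. -/
def IsFaithfulWeight (φ : PosCone A → ℝ≥0∞) : Prop := ∀ a, φ a = 0 → (a : A) = 0

/-- The domain of definition of `φ`: the span of `{a ∈ A₊ : φ(a) < ∞}`. -/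
def weightDomain (φ : PosCone A → ℝ≥0∞) : Submodule ℂ A :=
  Submodule.span ℂ {a | ∃ h : 0 ≤ a, φ ⟨a, h⟩ < ⊤}

/-- `c` is the value at `a = a₀ - a₁ + i (a₂ - a₃)`, with `aⱼ` positive and `φ(aⱼ) < ∞`, of the
linear extension of `φ`. -/
def HasWeightValue (φ : PosCone A → ℝ≥0∞) (a : A) (c : ℂ) : Prop :=
  ∃ a₀ a₁ a₂ a₃ : PosCone A, φ a₀ < ⊤ ∧ φ a₁ < ⊤ ∧ φ a₂ < ⊤ ∧ φ a₃ < ⊤ ∧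
    a = ((a₀ : A) - a₁) + Complex.I • ((a₂ : A) - a₃) ∧
    c = (((φ a₀).toReal - (φ a₁).toReal : ℝ) : ℂ) +
      Complex.I * (((φ a₂).toReal - (φ a₃).toReal : ℝ) : ℂ)

open Classical in
/-- The linear extension of `φ` to its domain of definition (and zero elsewhere). -/
def weightExt (φ : PosCone A → ℝ≥0∞) (a : A) : ℂ :=
  if h : ∃ c, HasWeightValue φ a c then h.choose else 0

end Trace

/-- A trace on a C⋆-algebra is semifinite (densely defined) if `{a ∈ A₊ : φ(a) < ∞}` is norm dense
in `A₊`. -/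
def IsDenselyDefined {A : Type*} [NonUnitalCStarAlgebra A] [PartialOrder A]
    (φ : PosCone A → ℝ≥0∞) : Prop :=
  Dense {a : PosCone A | φ a < ⊤}

section TraceLemmas

variable {A : Type*} [NonUnitalCStarAlgebra A] [PartialOrder A] [StarOrderedRing A]
  {φ : PosCone A → ℝ≥0∞}

lemma real_smul_nonneg {r : ℝ} (hr : 0 ≤ r) {a : A} (ha : 0 ≤ a) : 0 ≤ (r : ℂ) • a := by
  have : (r : ℂ) • a = r • a := by simp
  rw [this]
  exact smul_nonneg hr ha

namespace IsTrace

lemma mono (h : IsTrace φ) {a b : PosCone A} (hab : (a : A) ≤ b) : φ a ≤ φ b := by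
  rw [h.additive a ⟨(b : A) - a, sub_nonneg.2 hab⟩ b (by simp)]
  exact le_self_add

lemma apply_zero (h : IsTrace φ) : φ ⟨0, le_rfl⟩ = 0 := by
  have := h.homogeneous 0 ⟨0, le_rfl⟩ ⟨0, le_rfl⟩ (by simp)
  simpa using this

lemma hasWeightValue_of_nonneg (h : IsTrace φ) (a : PosCone A) (ha : φ a < ⊤) :
    HasWeightValue φ a ((φ a).toReal : ℂ) :=
  ⟨a, ⟨0, le_rfl⟩, ⟨0, le_rfl⟩, ⟨0, le_rfl⟩, ha, by simp [h.apply_zero], by simp [h.apply_zero],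
    by simp [h.apply_zero], by simp, by simp [h.apply_zero]⟩

lemma hasWeightValue_add (h : IsTrace φ) {a b : A} {c d : ℂ} (ha : HasWeightValue φ a c)
    (hb : HasWeightValue φ b d) : HasWeightValue φ (a + b) (c + d) := by
  obtain ⟨a₀, a₁, a₂, a₃, h0, h1, h2, h3, rfl, rfl⟩ := ha
  obtain ⟨b₀, b₁, b₂, b₃, k0, k1, k2, k3, rfl, rfl⟩ := hb
  have key : ∀ x y : PosCone A, φ ⟨x.1 + y.1, add_nonneg x.2 y.2⟩ = φ x + φ y :=
    fun x y => h.additive x y _ rfl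
  refine ⟨⟨_, add_nonneg a₀.2 b₀.2⟩, ⟨_, add_nonneg a₁.2 b₁.2⟩, ⟨_, add_nonneg a₂.2 b₂.2⟩,
    ⟨_, add_nonneg a₃.2 b₃.2⟩, ?_, ?_, ?_, ?_, ?_, ?_⟩
  · rw [key]; exact ENNReal.add_lt_top.2 ⟨h0, k0⟩
  · rw [key]; exact ENNReal.add_lt_top.2 ⟨h1, k1⟩
  · rw [key]; exact ENNReal.add_lt_top.2 ⟨h2, k2⟩
  · rw [key]; exact ENNReal.add_lt_top.2 ⟨h3, k3⟩
  · module
  · rw [key, key, key, key, ENNReal.toReal_add h0.ne k0.ne, ENNReal.toReal_add h1.ne k1.ne,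
      ENNReal.toReal_add h2.ne k2.ne, ENNReal.toReal_add h3.ne k3.ne]
    push_cast
    ring

lemma hasWeightValue_I_smul {a : A} {c : ℂ} (ha : HasWeightValue φ a c) :
    HasWeightValue φ (Complex.I • a) (Complex.I * c) := by
  obtain ⟨a₀, a₁, a₂, a₃, h0, h1, h2, h3, rfl, rfl⟩ := ha
  refine ⟨a₃, a₂, a₀, a₁, h3, h2, h0, h1, ?_, ?_⟩
  · rw [smul_add, smul_smul, Complex.I_mul_I]
    module
  · push_cast
    linear_combination
      (((φ a₂).toReal : ℂ) - ((φ a₃).toReal : ℂ)) * Complex.I_mul_I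

lemma hasWeightValue_nnreal_smul (h : IsTrace φ) (r : ℝ≥0) {a : A} {c : ℂ}
    (ha : HasWeightValue φ a c) :
    HasWeightValue φ (((r : ℝ) : ℂ) • a) (((r : ℝ) : ℂ) * c) := by
  obtain ⟨a₀, a₁, a₂, a₃, h0, h1, h2, h3, rfl, rfl⟩ := ha
  have key : ∀ x : PosCone A, φ ⟨((r : ℝ) : ℂ) • x.1, real_smul_nonneg r.coe_nonneg x.2⟩ = r * φ x :=
    fun x => h.homogeneous r x _ rfl
  refine ⟨⟨_, real_smul_nonneg r.coe_nonneg a₀.2⟩, ⟨_, real_smul_nonneg r.coe_nonneg a₁.2⟩,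
    ⟨_, real_smul_nonneg r.coe_nonneg a₂.2⟩, ⟨_, real_smul_nonneg r.coe_nonneg a₃.2⟩, ?_, ?_, ?_, ?_, ?_, ?_⟩
  · rw [key]; exact ENNReal.mul_lt_top ENNReal.coe_lt_top h0
  · rw [key]; exact ENNReal.mul_lt_top ENNReal.coe_lt_top h1
  · rw [key]; exact ENNReal.mul_lt_top ENNReal.coe_lt_top h2
  · rw [key]; exact ENNReal.mul_lt_top ENNReal.coe_lt_top h3
  · module
  · rw [key, key, key, key]
    simp only [ENNReal.toReal_mul, ENNReal.coe_toReal]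
    push_cast
    ring

lemma hasWeightValue_neg {a : A} {c : ℂ} (ha : HasWeightValue φ a c) :
    HasWeightValue φ (-a) (-c) := by
  have := hasWeightValue_I_smul (hasWeightValue_I_smul ha)
  rwa [smul_smul, ← mul_assoc, Complex.I_mul_I, neg_one_smul, neg_one_mul] at this

lemma hasWeightValue_smul (h : IsTrace φ) (z : ℂ) {a : A} {c : ℂ}
    (ha : HasWeightValue φ a c) : HasWeightValue φ (z • a) (z * c) := by
  have hr : ∀ (r : ℝ) {a : A} {c : ℂ}, HasWeightValue φ a c →
      HasWeightValue φ ((r : ℂ) • a) ((r : ℂ) * c) := by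
    intro r a c ha
    rcases le_total 0 r with hr | hr
    · have := h.hasWeightValue_nnreal_smul r.toNNReal ha
      rwa [Real.coe_toNNReal r hr] at this
    · have := hasWeightValue_neg (h.hasWeightValue_nnreal_smul (-r).toNNReal ha)
      rw [Real.coe_toNNReal (-r) (neg_nonneg.2 hr), ← neg_smul, ← neg_mul] at this
      simpa using this
  have := h.hasWeightValue_add (hr z.re ha) (hasWeightValue_I_smul (hr z.im ha))
  rw [smul_smul, ← add_smul, ← mul_assoc, ← add_mul, mul_comm Complex.I, Complex.re_add_im] at this
  exact this

lemma hasWeightValue_star {a : A} {c : ℂ} (ha : HasWeightValue φ a c) :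
    HasWeightValue φ (star a) (star c) := by
  obtain ⟨a₀, a₁, a₂, a₃, h0, h1, h2, h3, rfl, rfl⟩ := ha
  refine ⟨a₀, a₁, a₃, a₂, h0, h1, h3, h2, ?_, ?_⟩
  · simp only [star_add, star_sub, star_smul, (IsSelfAdjoint.of_nonneg a₀.2).star_eq,
      (IsSelfAdjoint.of_nonneg a₁.2).star_eq, (IsSelfAdjoint.of_nonneg a₂.2).star_eq,
      (IsSelfAdjoint.of_nonneg a₃.2).star_eq, Complex.star_def, Complex.conj_I]
    module
  · simp only [star_add, star_mul', Complex.star_def, Complex.conj_I, Complex.conj_ofReal]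
    push_cast
    ring

lemma hasWeightValue_unique (h : IsTrace φ) {a : A} {c d : ℂ} (ha : HasWeightValue φ a c)
    (hb : HasWeightValue φ a d) : c = d := by
  obtain ⟨a₀, a₁, a₂, a₃, h0, h1, h2, h3, rfl, rfl⟩ := ha
  obtain ⟨b₀, b₁, b₂, b₃, k0, k1, k2, k3, e, rfl⟩ := hb
  have es := congrArg star e
  simp only [star_add, star_sub, star_smul, (IsSelfAdjoint.of_nonneg a₀.2).star_eq,
      (IsSelfAdjoint.of_nonneg a₁.2).star_eq, (IsSelfAdjoint.of_nonneg a₂.2).star_eq,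
      (IsSelfAdjoint.of_nonneg a₃.2).star_eq, (IsSelfAdjoint.of_nonneg b₀.2).star_eq,
      (IsSelfAdjoint.of_nonneg b₁.2).star_eq, (IsSelfAdjoint.of_nonneg b₂.2).star_eq,
      (IsSelfAdjoint.of_nonneg b₃.2).star_eq, Complex.star_def, Complex.conj_I] at es
  have e1 : (a₀ : A) - a₁ = b₀ - b₁ := by
    have : (2 : ℂ) • ((a₀ : A) - a₁) = (2 : ℂ) • ((b₀ : A) - b₁) := by
      have e3 := congrArg₂ (· + ·) e es
      have l : ∀ x y : A, (2 : ℂ) • x = (x + Complex.I • y) + (x + (-Complex.I) • y) := by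
        intro x y; module
      rw [l _ ((a₂ : A) - a₃), l _ ((b₂ : A) - b₃)]
      exact e3
    exact smul_right_injective A (two_ne_zero' ℂ) this
  have e2 : (a₂ : A) - a₃ = b₂ - b₃ := by
    rw [e1] at e
    exact smul_right_injective A Complex.I_ne_zero (add_left_cancel e)
  have key : ∀ x y z w : PosCone A, φ x < ⊤ → φ y < ⊤ → φ z < ⊤ → φ w < ⊤ →
      (x : A) - y = z - w →
      (φ x).toReal - (φ y).toReal = (φ z).toReal - (φ w).toReal := by
    intro x y z w hx hy hz hw hxy
    have h1 := h.additive x w ⟨_, add_nonneg x.2 w.2⟩ rfl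
    have h2 := h.additive z y ⟨(x : A) + w, add_nonneg x.2 w.2⟩
      (sub_eq_sub_iff_add_eq_add.1 hxy)
    have h3 := congrArg ENNReal.toReal (h1.symm.trans h2)
    rw [ENNReal.toReal_add hx.ne hw.ne, ENNReal.toReal_add hz.ne hy.ne] at h3
    linarith
  rw [key a₀ a₁ b₀ b₁ h0 h1 k0 k1 e1, key a₂ a₃ b₂ b₃ h2 h3 k2 k3 e2]

lemma weightExt_eq (h : IsTrace φ) {a : A} {c : ℂ} (ha : HasWeightValue φ a c) :
    weightExt φ a = c := by
  have hex : ∃ c, HasWeightValue φ a c := ⟨c, ha⟩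
  rw [weightExt, dif_pos hex]
  exact h.hasWeightValue_unique hex.choose_spec ha

/-- `φ(x^* x) < ∞`. -/
def SqFinite (φ : PosCone A → ℝ≥0∞) (x : A) : Prop :=
  φ ⟨star x * x, star_mul_self_nonneg x⟩ < ⊤

lemma sqFinite_of_le (h : IsTrace φ) {x : A} (a : PosCone A) (ha : φ a < ⊤)
    (hx : star x * x ≤ a) : SqFinite φ x :=
  (h.mono (a := ⟨star x * x, star_mul_self_nonneg x⟩) hx).trans_lt ha

lemma sqFinite_smul (h : IsTrace φ) (z : ℂ) {x : A} (hx : SqFinite φ x) :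
    SqFinite φ (z • x) := by
  have key := h.homogeneous (‖z‖₊ ^ 2) ⟨star x * x, star_mul_self_nonneg x⟩
    ⟨star (z • x) * (z • x), star_mul_self_nonneg _⟩ (by
      simp only [star_smul, smul_mul_assoc, mul_smul_comm, smul_smul]
      congr 1
      rw [Complex.star_def, Complex.mul_conj']
      push_cast
      rfl)
  rw [SqFinite, key]
  exact ENNReal.mul_lt_top ENNReal.coe_lt_top hx

lemma sqFinite_add (h : IsTrace φ) {x y : A} (hx : SqFinite φ x) (hy : SqFinite φ y) :
    SqFinite φ (x + y) := by
  have k1 := h.additive ⟨star x * x, star_mul_self_nonneg x⟩ ⟨star y * y, star_mul_self_nonneg y⟩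
    ⟨star x * x + star y * y, add_nonneg (star_mul_self_nonneg x) (star_mul_self_nonneg y)⟩ rfl
  have hlt : φ ⟨star x * x + star y * y,
      add_nonneg (star_mul_self_nonneg x) (star_mul_self_nonneg y)⟩ < ⊤ := by
    rw [k1]; exact ENNReal.add_lt_top.2 ⟨hx, hy⟩
  have k2 := h.additive _ _ ⟨(star x * x + star y * y) + (star x * x + star y * y),
    add_nonneg (add_nonneg (star_mul_self_nonneg x) (star_mul_self_nonneg y))
      (add_nonneg (star_mul_self_nonneg x) (star_mul_self_nonneg y))⟩
      (rfl : _ = (⟨star x * x + star y * y,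
      add_nonneg (star_mul_self_nonneg x) (star_mul_self_nonneg y)⟩ : PosCone A).1 +
      (⟨star x * x + star y * y,
      add_nonneg (star_mul_self_nonneg x) (star_mul_self_nonneg y)⟩ : PosCone A).1)
  refine h.sqFinite_of_le _ (by rw [k2]; exact ENNReal.add_lt_top.2 ⟨hlt, hlt⟩) ?_
  have := star_mul_self_nonneg (x - y)
  rw [← sub_nonneg]
  convert this using 1
  simp only [star_add, star_sub, add_mul, mul_add, sub_mul, mul_sub]
  abel

lemma sqFinite_star (h : IsTrace φ) {x : A} (hx : SqFinite φ x) : SqFinite φ (star x) := by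
  have := h.tracial x ⟨_, star_mul_self_nonneg x⟩ ⟨star (star x) * star x,
    star_mul_self_nonneg (star x)⟩ rfl (by simp)
  rw [SqFinite, ← this]
  exact hx

lemma star_mul_mul_le (a x : A) :
    star (a * x) * (a * x) ≤ ((‖a‖ ^ 2 : ℝ) : ℂ) • (star x * x) := by
  have := CStarAlgebra.star_left_conjugate_le_norm_smul (a := x) (b := star a * a)
    (IsSelfAdjoint.star_mul_self a)
  rw [CStarRing.norm_star_mul_self, ← sq] at this
  simpa only [star_mul, mul_assoc, Complex.coe_smul] using this

lemma sq_mul_le (h : IsTrace φ) (a x : A) :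
    φ ⟨star (a * x) * (a * x), star_mul_self_nonneg _⟩ ≤
      ((‖a‖₊ ^ 2 : ℝ≥0) : ℝ≥0∞) * φ ⟨star x * x, star_mul_self_nonneg x⟩ := by
  rw [← h.homogeneous (‖a‖₊ ^ 2) ⟨star x * x, star_mul_self_nonneg x⟩
    ⟨_, real_smul_nonneg (NNReal.coe_nonneg _) (star_mul_self_nonneg x)⟩ rfl]
  refine h.mono ?_
  simpa using star_mul_mul_le a x

lemma sqFinite_mul_left (h : IsTrace φ) (a : A) {x : A} (hx : SqFinite φ x) :
    SqFinite φ (a * x) :=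
  (h.sq_mul_le a x).trans_lt (ENNReal.mul_lt_top ENNReal.coe_lt_top hx)

lemma sqFinite_mul_right (h : IsTrace φ) {x : A} (a : A) (hx : SqFinite φ x) :
    SqFinite φ (x * a) := by
  have := h.sqFinite_star (h.sqFinite_mul_left (star a) (h.sqFinite_star hx))
  simpa using this

lemma exists_hasWeightValue (h : IsTrace φ) {x y : A} (hx : SqFinite φ x) (hy : SqFinite φ y) :
    ∃ c, HasWeightValue φ (star x * y) c := by
  have hv : ∀ {x : A}, SqFinite φ x → ∃ c, HasWeightValue φ (star x * x) c :=
    fun {x} hx => ⟨_, h.hasWeightValue_of_nonneg ⟨star x * x, star_mul_self_nonneg x⟩ hx⟩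
  obtain ⟨c0, h0⟩ := hv (h.sqFinite_add hx hy)
  obtain ⟨c1, h1⟩ := hv (h.sqFinite_add hx (h.sqFinite_smul (-1) hy))
  obtain ⟨c2, h2⟩ := hv (h.sqFinite_add hx (h.sqFinite_smul Complex.I hy))
  obtain ⟨c3, h3⟩ := hv (h.sqFinite_add hx (h.sqFinite_smul (-Complex.I) hy))
  have := h.hasWeightValue_add
    (h.hasWeightValue_add (h.hasWeightValue_smul (1 / 4) h0)
      (h.hasWeightValue_smul (-1 / 4) h1))
    (h.hasWeightValue_add (h.hasWeightValue_smul (-Complex.I / 4) h2)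
      (h.hasWeightValue_smul (Complex.I / 4) h3))
  refine ⟨_, (congrArg (fun t => HasWeightValue φ t _) ?_).mp this⟩
  simp only [star_add, star_smul, add_mul, mul_add, smul_mul_assoc, mul_smul_comm, smul_smul,
    smul_add, star_neg, star_one, Complex.star_def, Complex.conj_I]
  match_scalars <;> ring_nf <;> simp [Complex.I_sq] <;> ring_nf

/-- A densely defined trace is finite on projections. -/
lemma sqFinite_projection (h : IsTrace φ) (hd : IsDenselyDefined φ) {p : A}
    (hp : IsStarProjection p) : SqFinite φ p := by
  have hps : star p = p := hp.isSelfAdjoint.star_eq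
  have hpp : p * p = p := hp.isIdempotentElem.eq
  have hp0 : 0 ≤ p := by rw [← hpp]; nth_rewrite 1 [← hps]; exact star_mul_self_nonneg p
  obtain ⟨a, ha, hdist⟩ := Metric.dense_iff.1 hd ⟨p, hp0⟩ (1 / 2) (by norm_num)
  have hnorm : ‖p - (a : A)‖ ≤ 1 / 2 := by
    have : dist (a : A) p < 1 / 2 := ha
    rw [dist_eq_norm, norm_sub_rev] at this
    exact this.le
  have hsa : IsSelfAdjoint (p - (a : A)) := hp.isSelfAdjoint.sub (IsSelfAdjoint.of_nonneg a.2)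
  set s := CFC.sqrt (a : A) with hs
  have hs0 : 0 ≤ s := CFC.sqrt_nonneg _
  have hss : star s = s := (IsSelfAdjoint.of_nonneg hs0).star_eq
  have hs2 : s * s = a := CFC.sqrt_mul_sqrt_self (a : A) a.2
  have hsf : SqFinite φ s := by
    have : (⟨star s * s, star_mul_self_nonneg s⟩ : PosCone A) = a :=
      Subtype.ext ((congrArg (· * s) hss).trans hs2)
    rw [SqFinite, this]
    exact hdist
  have h2 : SqFinite φ (((2 : ℝ) : ℂ) • (s * p)) := h.sqFinite_smul _ (h.sqFinite_mul_right p hsf)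
  refine h.sqFinite_of_le ⟨_, star_mul_self_nonneg _⟩ h2 ?_
  have k := CStarAlgebra.star_left_conjugate_le_norm_smul (a := p) hsa
  rw [hps, hpp, mul_sub, sub_mul, hpp, hpp] at k
  have k2 : ‖p - (a : A)‖ • p ≤ (1 / 2 : ℝ) • p := smul_le_smul_of_nonneg_right hnorm hp0
  have k3 : (1 / 2 : ℝ) • p ≤ p * a * p := by
    have := k.trans k2
    rw [sub_le_comm] at this
    refine le_trans (le_of_eq ?_) this
    module
  have hpap : 0 ≤ p * a * p := (smul_nonneg (by norm_num) hp0).trans k3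
  have e : star (((2 : ℝ) : ℂ) • (s * p)) * (((2 : ℝ) : ℂ) • (s * p)) = (4 : ℝ) • (p * a * p) := by
    simp only [star_smul, smul_mul_assoc, mul_smul_comm, smul_smul, star_mul, hps, hss, ← hs2,
      mul_assoc]
    rw [← Complex.coe_smul]
    congr 1
    simp
    norm_num
  change star p * p ≤ star (((2 : ℝ) : ℂ) • (s * p)) * (((2 : ℝ) : ℂ) • (s * p))
  rw [e, hps, hpp]
  calc p = (2 : ℝ) • ((1 / 2 : ℝ) • p) := by module
    _ ≤ (2 : ℝ) • (p * a * p) := smul_le_smul_of_nonneg_left k3 (by norm_num)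
    _ ≤ (4 : ℝ) • (p * a * p) := smul_le_smul_of_nonneg_right (by norm_num) hpap

end IsTrace

end TraceLemmas

namespace RowFiniteGraph

variable {V : Type u} {E : Type v}

namespace CStar

variable (G : RowFiniteGraph V E)

/-! ### The dense subalgebra `A_c` -/

/-- `S_{μ₁} ⋯ S_{μₙ} p_{r(μₙ)} = S_{μ₁} ⋯ S_{μₙ}`, and `p_v` for the empty list. -/
def word : V → List E → G.CStar
  | v, [] => p G v
  | _, e :: l => S G e * word (G.rng e) l

/-- `S_μ = S_{μ₁} ⋯ S_{μₙ}` for a path `μ`, and `S_v = p_v` for a vertex `v`. -/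
def path (μ : G.FinPath) : G.CStar := word G μ.source μ.edges

/-- `A_c`, the finite linear span of the generators `S_μ S_ν^*`, `r(μ) = r(ν)`. -/
def Ac : Submodule ℂ G.CStar :=
  Submodule.span ℂ {a | ∃ μ ν : G.FinPath, μ.range = ν.range ∧ a = path G μ * star (path G ν)}

lemma p_star (v : V) : star (p G v) = p G v :=
  ((family G).isStarProjection_p v).isSelfAdjoint.star_eq

lemma p_sq (v : V) : p G v * p G v = p G v :=
  ((family G).isStarProjection_p v).isIdempotentElem.eq

lemma p_orth {v w : V} (h : v ≠ w) : p G v * p G w = 0 := (family G).p_mul_p v w h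

lemma star_S_mul_S (e : E) : star (S G e) * S G e = p G (G.rng e) := (family G).star_S_mul_S e

lemma S_mul_p (e : E) : S G e * p G (G.rng e) = S G e := by
  rw [← star_S_mul_S, ← mul_assoc]
  exact (family G).isPartialIsometry e

lemma isStarProjection_S_star (e : E) : IsStarProjection (S G e * star (S G e)) :=
  ⟨by
    rw [IsIdempotentElem, ← mul_assoc]
    exact congrArg (· * star (S G e)) ((family G).isPartialIsometry e),
    IsSelfAdjoint.mul_star_self _⟩

/-- Projections with sum a projection are mutually orthogonal. -/
lemma orth_of_sum {B ι : Type*} [NonUnitalCStarAlgebra B] (s : Finset ι) (q : ι → B)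
    (hq : ∀ i ∈ s, IsStarProjection (q i)) (hs : IsStarProjection (∑ i ∈ s, q i))
    {i j : ι} (hi : i ∈ s) (hj : j ∈ s) (hij : i ≠ j) : q i * q j = 0 := by
  let _ : PartialOrder B := CStarAlgebra.spectralOrder B
  have _ : StarOrderedRing B := CStarAlgebra.spectralOrderedRing B
  classical
  have hnn : ∀ (k : ι), k ∈ s → 0 ≤ star (q k * q j) * (q k * q j) :=
    fun k _ => star_mul_self_nonneg _
  have hk : ∀ k ∈ s, star (q k * q j) * (q k * q j) = q j * q k * q j := by
    intro k hk
    rw [star_mul, (hq k hk).isSelfAdjoint.star_eq, (hq j hj).isSelfAdjoint.star_eq]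
    simp only [mul_assoc]
    rw [← mul_assoc (q k) (q k), (hq k hk).isIdempotentElem.eq]
  set P := ∑ i ∈ s, q i with hP
  -- `q_j P q_j ≤ q_j`
  have h1 : q j * P * q j ≤ q j := by
    have := CStarAlgebra.star_left_conjugate_le_norm_smul (a := q j) hs.isSelfAdjoint
    rw [(hq j hj).isSelfAdjoint.star_eq, (hq j hj).isIdempotentElem.eq] at this
    refine this.trans ?_
    have hn : ‖P‖ ≤ 1 := by
      have h := CStarRing.norm_star_mul_self (x := P)
      rw [hs.isSelfAdjoint.star_eq, hs.isIdempotentElem.eq] at h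
      nlinarith [norm_nonneg P]
    have hqj : 0 ≤ q j := by
      rw [← (hq j hj).isIdempotentElem.eq]
      nth_rewrite 1 [← (hq j hj).isSelfAdjoint.star_eq]
      exact star_mul_self_nonneg _
    calc ‖P‖ • q j ≤ (1 : ℝ) • q j := smul_le_smul_of_nonneg_right hn hqj
      _ = q j := one_smul _ _
  have h2 : q j * P * q j = q j + ∑ k ∈ s.erase j, star (q k * q j) * (q k * q j) := by
    rw [hP, Finset.mul_sum, Finset.sum_mul, ← Finset.add_sum_erase s _ hj]
    congr 1
    · rw [(hq j hj).isIdempotentElem.eq, (hq j hj).isIdempotentElem.eq]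
    · exact Finset.sum_congr rfl fun k hk' => (hk k (Finset.mem_of_mem_erase hk')).symm
  have h3 : ∑ k ∈ s.erase j, star (q k * q j) * (q k * q j) = 0 := by
    refine le_antisymm ?_ (Finset.sum_nonneg fun k hk' => hnn k (Finset.mem_of_mem_erase hk'))
    rw [h2] at h1
    simpa using h1
  have h4 := (Finset.sum_eq_zero_iff_of_nonneg
    (fun k hk' => hnn k (Finset.mem_of_mem_erase hk'))).1 h3 i (Finset.mem_erase.2 ⟨hij, hi⟩)
  exact CStarRing.star_mul_self_eq_zero_iff _ |>.1 h4

lemma p_mul_S (e : E) : p G (G.src e) * S G e = S G e := by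
  classical
  have hsum := (family G).p_eq_sum (G.src e) ⟨e, rfl⟩
  have he : e ∈ (G.row_finite (G.src e)).toFinset := by simp
  have horth : ∀ f ∈ (G.row_finite (G.src e)).toFinset, f ≠ e →
      S G f * star (S G f) * S G e = 0 := by
    intro f hf hfe
    have := orth_of_sum (G.row_finite (G.src e)).toFinset (fun f => S G f * star (S G f))
      (fun f _ => isStarProjection_S_star G f) (hsum ▸ (family G).isStarProjection_p _) hf he hfe
    calc S G f * star (S G f) * S G e
        = S G f * star (S G f) * (S G e * star (S G e) * S G e) := by
          congr 1; exact ((family G).isPartialIsometry e).symm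
      _ = (S G f * star (S G f)) * (S G e * star (S G e)) * S G e := by simp only [mul_assoc]
      _ = 0 := by rw [this, zero_mul]
  have hsum' : p G (G.src e) = ∑ e ∈ (G.row_finite (G.src e)).toFinset, S G e * star (S G e) :=
    hsum
  rw [hsum', Finset.sum_mul, Finset.sum_eq_single e horth (fun h => absurd he h)]
  exact (family G).isPartialIsometry e

lemma star_S_mul_S_of_ne {e f : E} (h : e ≠ f) : star (S G e) * S G f = 0 := by
  classical
  have k : S G e * star (S G e) * (S G f * star (S G f)) = 0 := by
    by_cases hs : G.src e = G.src f
    · have hsum := (family G).p_eq_sum (G.src e) ⟨e, rfl⟩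
      exact orth_of_sum (G.row_finite (G.src e)).toFinset (fun f => S G f * star (S G f))
        (fun f _ => isStarProjection_S_star G f) (hsum ▸ (family G).isStarProjection_p _)
        (by simp) (by simp [hs]) h
    · have h1 : star (S G e) * S G f = 0 := by
        rw [← p_mul_S G e, ← p_mul_S G f, star_mul, p_star, mul_assoc, ← mul_assoc (p G _) (p G _),
          p_orth G hs, zero_mul, mul_zero]
      rw [mul_assoc, ← mul_assoc (star _), h1, zero_mul, mul_zero]
  have he : star (S G e) * S G e * star (S G e) = star (S G e) := by
    have := congrArg star ((family G).isPartialIsometry e)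
    simpa [mul_assoc] using! this
  have hf : S G f * star (S G f) * S G f = S G f := (family G).isPartialIsometry f
  calc star (S G e) * S G f
      = (star (S G e) * S G e * star (S G e)) * (S G f * star (S G f) * S G f) := by rw [he, hf]
    _ = star (S G e) * (S G e * star (S G e) * (S G f * star (S G f))) * S G f := by
        simp only [mul_assoc]
    _ = 0 := by rw [k, mul_zero, zero_mul]

lemma p_mul_word (v : V) (l : List E) (h : G.IsPathFrom v l) :
    p G v * word G v l = word G v l := by
  cases l with
  | nil => exact p_sq G v
  | cons e l =>
    obtain ⟨rfl, _⟩ := h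
    simp only [word]
    rw [← mul_assoc, p_mul_S]

lemma word_mul_p (v : V) (l : List E) : word G v l * p G (G.rangeFrom v l) = word G v l := by
  induction l generalizing v with
  | nil => exact p_sq G v
  | cons e l ih => simp only [word, rangeFrom, mul_assoc, ih]

lemma word_concat (v : V) (l : List E) (e : E) (h : G.IsPathFrom v l)
    (he : G.src e = G.rangeFrom v l) :
    G.IsPathFrom v (l ++ [e]) ∧ G.rangeFrom v (l ++ [e]) = G.rng e ∧
      word G v l * S G e = word G v (l ++ [e]) := by
  induction l generalizing v with
  | nil =>
    simp only [rangeFrom] at he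
    subst he
    exact ⟨⟨rfl, trivial⟩, rfl, by simp only [List.nil_append, word, p_mul_S, S_mul_p]⟩
  | cons f l ih =>
    obtain ⟨hf, hl⟩ := h
    obtain ⟨h1, h2, h3⟩ := ih (G.rng f) hl he
    exact ⟨⟨hf, h1⟩, h2, by simp only [List.cons_append, word, mul_assoc, h3]⟩

lemma path_mul_star_mem (μ ν : G.FinPath) : path G μ * star (path G ν) ∈ Ac G := by
  by_cases h : μ.range = ν.range
  · exact Submodule.subset_span ⟨μ, ν, h, rfl⟩
  · have h1 := word_mul_p G μ.source μ.edges
    have h2 := word_mul_p G ν.source ν.edges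
    have : path G μ * star (path G ν) = 0 := by
      rw [path, path, ← h1, ← h2, star_mul, p_star, mul_assoc, ← mul_assoc (p G _) (p G _)]
      rw [p_orth G (v := G.rangeFrom μ.source μ.edges) (w := G.rangeFrom ν.source ν.edges) h,
        zero_mul, mul_zero]
    rw [this]
    exact zero_mem _

lemma star_mem_Ac {a : G.CStar} (ha : a ∈ Ac G) : star a ∈ Ac G := by
  induction ha using Submodule.span_induction with
  | mem x hx =>
    obtain ⟨μ, ν, _, rfl⟩ := hx
    rw [star_mul, star_star]
    exact path_mul_star_mem G ν μ
  | zero => rw [star_zero]; exact zero_mem _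
  | add x y _ _ hx hy => rw [star_add]; exact add_mem hx hy
  | smul c x _ hx => rw [star_smul]; exact Submodule.smul_mem _ _ hx

/-- A right multiplication that preserves `A_c` on generators preserves `A_c`. -/
lemma mul_mem_Ac_of {b : G.CStar}
    (h : ∀ μ ν : G.FinPath, μ.range = ν.range → path G μ * star (path G ν) * b ∈ Ac G)
    {a : G.CStar} (ha : a ∈ Ac G) : a * b ∈ Ac G := by
  induction ha using Submodule.span_induction with
  | mem x hx => obtain ⟨μ, ν, hr, rfl⟩ := hx; exact h μ ν hr
  | zero => rw [zero_mul]; exact zero_mem _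
  | add x y _ _ hx hy => rw [add_mul]; exact add_mem hx hy
  | smul c x _ hx => rw [smul_mul_assoc]; exact Submodule.smul_mem _ _ hx

lemma mul_p_mem {a : G.CStar} (ha : a ∈ Ac G) (v : V) : a * p G v ∈ Ac G := by
  refine mul_mem_Ac_of G (fun μ ν _ => ?_) ha
  have h1 := p_mul_word G ν.source ν.edges ν.isPath
  by_cases h : ν.source = v
  · have : star (path G ν) * p G v = star (path G ν) := by
      rw [← p_star G v, ← star_mul, ← h]
      exact congrArg star h1
    rw [mul_assoc, this]
    exact path_mul_star_mem G μ ν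
  · have : star (path G ν) * p G v = 0 := by
      rw [path, ← h1, star_mul, p_star, mul_assoc, p_orth G h, mul_zero]
    rw [mul_assoc, this, mul_zero]
    exact zero_mem _

lemma mul_star_S_mem {a : G.CStar} (ha : a ∈ Ac G) (e : E) : a * star (S G e) ∈ Ac G := by
  refine mul_mem_Ac_of G (fun μ ν _ => ?_) ha
  rw [mul_assoc, ← star_mul]
  by_cases h : G.rng e = ν.source
  · have : S G e * path G ν =
        path G ⟨G.src e, e :: ν.edges, ⟨rfl, by rw [h]; exact ν.isPath⟩⟩ := by
      simp only [path, word, h]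
    rw [this]
    exact path_mul_star_mem G μ _
  · have : S G e * path G ν = 0 := by
      rw [path, ← p_mul_word G ν.source ν.edges ν.isPath, ← S_mul_p, mul_assoc,
        ← mul_assoc (p G _) (p G _), p_orth G h, zero_mul, mul_zero]
    rw [this, star_zero, mul_zero]
    exact zero_mem _

lemma mul_S_mem {a : G.CStar} (ha : a ∈ Ac G) (e : E) : a * S G e ∈ Ac G := by
  refine mul_mem_Ac_of G (fun μ ν hr => ?_) ha
  obtain ⟨w, l, hl⟩ := ν
  cases l with
  | nil =>
    have hr' : G.rangeFrom μ.source μ.edges = w := hr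
    have h0 : path G μ * star (path G ⟨w, [], hl⟩) = path G μ := by
      simp only [path, word, p_star]
      rw [← hr', word_mul_p]
    rw [h0]
    by_cases h : G.src e = w
    · obtain ⟨h1, h2, h3⟩ := word_concat G μ.source μ.edges e μ.isPath (h.trans hr'.symm)
      have : path G μ * S G e = path G ⟨_, _, h1⟩ * star (path G ⟨G.rng e, [], trivial⟩) := by
        simp only [path, word, p_star]
        rw [← h2, word_mul_p]
        exact h3
      rw [this]
      exact path_mul_star_mem G _ _
    · have : path G μ * S G e = 0 := by
        rw [path, ← word_mul_p, ← p_mul_S, mul_assoc, ← mul_assoc (p G _) (p G _),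
          p_orth G (fun h' => h (by rw [← hr', h'])), zero_mul, mul_zero]
      rw [this]
      exact zero_mem _
  | cons f l =>
    simp only [path, word, star_mul, mul_assoc]
    by_cases h : f = e
    · subst h
      rw [star_S_mul_S, ← mul_assoc]
      exact mul_p_mem G (path_mul_star_mem G μ ⟨G.rng f, l, hl.2⟩) _
    · rw [star_S_mul_S_of_ne G h, mul_zero, mul_zero]
      exact zero_mem _

lemma mul_word_mem (l : List E) (v : V) {a : G.CStar} (ha : a ∈ Ac G) :
    a * word G v l ∈ Ac G := by
  induction l generalizing v a with
  | nil => exact mul_p_mem G ha v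
  | cons e l ih =>
    simp only [word]
    rw [← mul_assoc]
    exact ih _ (mul_S_mem G ha e)

lemma mul_star_word_mem (l : List E) (v : V) {a : G.CStar} (ha : a ∈ Ac G) :
    a * star (word G v l) ∈ Ac G := by
  induction l generalizing v a with
  | nil => simp only [word, p_star]; exact mul_p_mem G ha v
  | cons e l ih =>
    simp only [word, star_mul]
    rw [← mul_assoc]
    exact mul_star_S_mem G (ih _ ha) e

lemma mul_mem_Ac {a b : G.CStar} (ha : a ∈ Ac G) (hb : b ∈ Ac G) : a * b ∈ Ac G := by
  induction hb using Submodule.span_induction with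
  | mem x hx =>
    obtain ⟨μ, ν, _, rfl⟩ := hx
    rw [← mul_assoc]
    exact mul_star_word_mem G _ _ (mul_word_mem G _ _ ha)
  | zero => rw [mul_zero]; exact zero_mem _
  | add x y _ _ hx hy => rw [mul_add]; exact add_mem hx hy
  | smul c x _ hx => rw [mul_smul_comm]; exact Submodule.smul_mem _ _ hx

lemma p_mem_Ac (v : V) : p G v ∈ Ac G := by
  have : p G v = path G ⟨v, [], trivial⟩ * star (path G ⟨v, [], trivial⟩) := by
    simp only [path, word, p_star, p_sq]
  rw [this]
  exact path_mul_star_mem G _ _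

lemma path_mem_Ac (μ : G.FinPath) : path G μ ∈ Ac G := by
  have : path G μ = path G μ * star (path G ⟨μ.range, [], trivial⟩) := by
    simp only [path, word, p_star]
    exact (word_mul_p G _ _).symm
  rw [this]
  exact path_mul_star_mem G _ _

/-! ### The expectation on `A_c` -/

lemma gauge_word (z : Circle) (v : V) (l : List E) :
    gauge G z (word G v l) = ((z : ℂ) ^ l.length) • word G v l := by
  induction l generalizing v with
  | nil => simp only [word, gauge_p, List.length_nil, pow_zero, one_smul]
  | cons e l ih =>
    simp only [word, map_mul, gauge_S, ih, List.length_cons, smul_mul_assoc, mul_smul_comm,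
      smul_smul, pow_succ]

lemma gauge_gen (z : Circle) (μ ν : G.FinPath) :
    gauge G z (path G μ * star (path G ν)) =
      ((z ^ ((μ.length : ℤ) - ν.length) : Circle) : ℂ) • (path G μ * star (path G ν)) := by
  rw [map_mul, map_star, path, path, gauge_word, gauge_word, star_smul, smul_mul_assoc,
    mul_smul_comm, smul_smul]
  congr 1
  rw [zpow_sub]
  simp only [FinPath.length, zpow_natCast, Circle.coe_mul, Circle.coe_inv_eq_conj, Circle.coe_pow,
    map_pow, Complex.star_def]

lemma coe_exp_zpow (k : ℤ) (θ : ℝ) :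
    (((Circle.exp θ) ^ k : Circle) : ℂ) = Complex.exp ((k * Complex.I) * θ) := by
  rw [Circle.coe_zpow, Circle.coe_exp, ← Complex.exp_int_mul]
  congr 1
  ring

lemma continuous_gauge_of_mem {a : G.CStar} (ha : a ∈ Ac G) :
    Continuous fun θ : ℝ => gauge G (Circle.exp θ) a := by
  induction ha using Submodule.span_induction with
  | mem x hx =>
    obtain ⟨μ, ν, _, rfl⟩ := hx
    simp only [gauge_gen]
    have h : Continuous fun θ : ℝ =>
        (((Circle.exp θ) ^ ((μ.length : ℤ) - ν.length) : Circle) : ℂ) := by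
      simp only [coe_exp_zpow]
      fun_prop
    exact h.smul (continuous_const (y := path G μ * star (path G ν)))
  | zero =>
    simp only [map_zero]
    exact continuous_const
  | add x y _ _ hx hy => simp only [map_add]; exact hx.add hy
  | smul c x _ hx => simp only [map_smul]; exact hx.const_smul c

lemma expect_add {a b : G.CStar} (ha : a ∈ Ac G) (hb : b ∈ Ac G) :
    expect G (a + b) = expect G a + expect G b := by
  simp only [expect, map_add]
  rw [intervalIntegral.integral_add
    ((continuous_gauge_of_mem G ha).intervalIntegrable _ _)
    ((continuous_gauge_of_mem G hb).intervalIntegrable _ _), smul_add]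

lemma expect_smul (c : ℂ) (a : G.CStar) : expect G (c • a) = c • expect G a := by
  simp only [expect, map_smul]
  rw [intervalIntegral.integral_smul, smul_comm]

lemma expect_zero : expect G 0 = 0 := by
  simp [expect]

lemma integral_exp_zpow (k : ℤ) (hk : k ≠ 0) :
    ∫ θ in (0 : ℝ)..(2 * Real.pi), (((Circle.exp θ) ^ k : Circle) : ℂ) = 0 := by
  have hc : (k : ℂ) * Complex.I ≠ 0 := mul_ne_zero (by exact_mod_cast hk) Complex.I_ne_zero
  simp only [coe_exp_zpow]
  rw [integral_exp_mul_complex hc]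
  have h1 : Complex.exp ((k : ℂ) * Complex.I * ((2 * Real.pi : ℝ) : ℂ)) = 1 := by
    rw [Complex.exp_eq_one_iff]
    exact ⟨k, by push_cast; ring⟩
  rw [h1]
  simp

lemma expect_gen (μ ν : G.FinPath) :
    expect G (path G μ * star (path G ν)) =
      if μ.length = ν.length then path G μ * star (path G ν) else 0 := by
  simp only [expect, gauge_gen]
  rw [intervalIntegral.integral_smul_const]
  split_ifs with h
  · rw [h]
    simp only [sub_self, zpow_zero, Circle.coe_one, intervalIntegral.integral_const, sub_zero]
    rw [smul_assoc, one_smul, smul_smul, inv_mul_cancel₀ (by positivity), one_smul]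
  · rw [integral_exp_zpow _ (by omega), zero_smul, smul_zero]

lemma expect_mem_Ac {a : G.CStar} (ha : a ∈ Ac G) : expect G a ∈ Ac G := by
  induction ha using Submodule.span_induction with
  | mem x hx =>
    obtain ⟨μ, ν, hr, rfl⟩ := hx
    rw [expect_gen]
    split_ifs
    · exact path_mul_star_mem G μ ν
    · exact zero_mem _
  | zero => rw [expect_zero]; exact zero_mem _
  | add x y hx' hy' hx hy => rw [expect_add G hx' hy']; exact add_mem hx hy
  | smul c x _ hx => rw [expect_smul]; exact Submodule.smul_mem _ _ hx

lemma expect_expect {a : G.CStar} (ha : a ∈ Ac G) : expect G (expect G a) = expect G a := by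
  induction ha using Submodule.span_induction with
  | mem x hx =>
    obtain ⟨μ, ν, hr, rfl⟩ := hx
    rw [expect_gen]
    split_ifs with h
    · rw [expect_gen, if_pos h]
    · exact expect_zero G
  | zero => rw [expect_zero, expect_zero]
  | add x y hx' hy' hx hy =>
    rw [expect_add G hx' hy', expect_add G (expect_mem_Ac G hx') (expect_mem_Ac G hy'), hx, hy]
  | smul c x _ hx => rw [expect_smul, expect_smul, hx]

end CStar
end RowFiniteGraph

namespace RowFiniteGraph

variable {V : Type u} {E : Type v}

/-! ### The Hilbert space -/

/-- A faithful, semifinite, norm lower-semicontinuous, gauge invariant trace on `C^*(G)`. -/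
structure GaugeTrace (G : RowFiniteGraph V E) where
  toFun : PosCone G.CStar → ℝ≥0∞
  isTrace : IsTrace toFun
  faithful : IsFaithfulWeight toFun
  semifinite : IsDenselyDefined toFun
  lowerSemicontinuous : LowerSemicontinuous toFun
  gauge_invariant : ∀ (z : Circle) (a b : PosCone G.CStar),
    (b : G.CStar) = CStar.gauge G z a → toFun b = toFun a

namespace GaugeTrace

variable {G : RowFiniteGraph V E} (τ : G.GaugeTrace)

/-- The linear extension of `τ` to its domain of definition. -/
def ext (a : G.CStar) : ℂ := weightExt τ.toFun a

open CStar IsTrace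

lemma sqFinite_word (v : V) (l : List E) : SqFinite τ.toFun (word G v l) := by
  induction l generalizing v with
  | nil => exact τ.isTrace.sqFinite_projection τ.semifinite ((family G).isStarProjection_p v)
  | cons e l ih => exact τ.isTrace.sqFinite_mul_left _ (ih _)

lemma sqFinite_Ac {a : G.CStar} (ha : a ∈ Ac G) : SqFinite τ.toFun a := by
  induction ha using Submodule.span_induction with
  | mem x hx =>
    obtain ⟨μ, ν, _, rfl⟩ := hx
    exact τ.isTrace.sqFinite_mul_right _ (τ.sqFinite_word _ _)
  | zero =>
    have := τ.isTrace.apply_zero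
    have h2 : (⟨star (0 : G.CStar) * 0, star_mul_self_nonneg _⟩ : PosCone G.CStar) =
      ⟨0, le_rfl⟩ := Subtype.ext (by simp)
    rw [SqFinite, h2, this]
    exact ENNReal.zero_lt_top
  | add x y _ _ hx hy => exact τ.isTrace.sqFinite_add hx hy
  | smul c x _ hx => exact τ.isTrace.sqFinite_smul c hx

lemma hasValue {a b : G.CStar} (ha : a ∈ Ac G) (hb : b ∈ Ac G) :
    HasWeightValue τ.toFun (star a * b) (τ.ext (star a * b)) := by
  obtain ⟨c, hc⟩ := τ.isTrace.exists_hasWeightValue (τ.sqFinite_Ac ha) (τ.sqFinite_Ac hb)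
  rw [ext, τ.isTrace.weightExt_eq hc]
  exact hc

lemma hasValue_self {a : G.CStar} (ha : a ∈ Ac G) :
    τ.ext (star a * a) = ((τ.toFun ⟨star a * a, star_mul_self_nonneg a⟩).toReal : ℂ) :=
  τ.isTrace.weightExt_eq (τ.isTrace.hasWeightValue_of_nonneg ⟨star a * a, star_mul_self_nonneg a⟩
    (τ.sqFinite_Ac ha))

/-- `X_c`, the copy of `A_c` that carries the inner product `⟨x, y⟩ = τ(x^* y)`. -/
def Xc (_ : G.GaugeTrace) : Type _ := Ac G

instance : AddCommGroup τ.Xc := inferInstanceAs (AddCommGroup (Ac G))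

instance : Module ℂ τ.Xc := inferInstanceAs (Module ℂ (Ac G))

/-- The inclusion of `X_c = A_c` in `C^*(G)`. -/
def val : τ.Xc →ₗ[ℂ] G.CStar := (Ac G).subtype

lemma val_mem (x : τ.Xc) : τ.val x ∈ Ac G := Subtype.property (p := fun a => a ∈ Ac G) x

lemma val_injective : Function.Injective τ.val := Subtype.val_injective

/-- An element of `A_c` as an element of `X_c`. -/
def ofAc (a : G.CStar) (ha : a ∈ Ac G) : τ.Xc := ⟨a, ha⟩

@[simp] lemma val_ofAc (a : G.CStar) (ha : a ∈ Ac G) : τ.val (τ.ofAc a ha) = a := rfl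

/-- The inner product `⟨x, y⟩ = τ(x^* y)` on `X_c`. -/
@[reducible] def innerCore : InnerProductSpace.Core ℂ τ.Xc where
  inner x y := τ.ext (star (τ.val x) * τ.val y)
  conj_inner_symm x y := by
    have h := hasWeightValue_star (τ.hasValue (τ.val_mem y) (τ.val_mem x))
    rw [star_mul, star_star] at h
    exact (τ.isTrace.weightExt_eq h).symm
  re_inner_nonneg x := by
    rw [τ.hasValue_self (τ.val_mem x)]
    exact ENNReal.toReal_nonneg
  add_left x y z := by
    refine τ.isTrace.weightExt_eq ?_
    rw [map_add, star_add, add_mul]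
    exact τ.isTrace.hasWeightValue_add (τ.hasValue (τ.val_mem x) (τ.val_mem z))
      (τ.hasValue (τ.val_mem y) (τ.val_mem z))
  smul_left x y r := by
    refine τ.isTrace.weightExt_eq ?_
    rw [map_smul, star_smul, smul_mul_assoc]
    exact τ.isTrace.hasWeightValue_smul _ (τ.hasValue (τ.val_mem x) (τ.val_mem y))
  definite x h := by
    rw [τ.hasValue_self (τ.val_mem x)] at h
    have h1 : (τ.toFun ⟨star (τ.val x) * τ.val x, star_mul_self_nonneg _⟩).toReal = 0 := by
      exact_mod_cast h
    rw [ENNReal.toReal_eq_zero_iff] at h1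
    have h2 := τ.faithful _ (h1.resolve_right (τ.sqFinite_Ac (τ.val_mem x)).ne)
    have h3 : τ.val x = 0 := (CStarRing.star_mul_self_eq_zero_iff _).1 h2
    exact τ.val_injective (h3.trans (map_zero _).symm)

instance : NormedAddCommGroup τ.Xc := τ.innerCore.toNormedAddCommGroup

instance : InnerProductSpace ℂ τ.Xc := InnerProductSpace.ofCore τ.innerCore.toCore

lemma inner_def (x y : τ.Xc) : inner ℂ x y = τ.ext (star (τ.val x) * τ.val y) := rfl

/-- The Hilbert space `L²(X, τ)`, the completion of `X_c`. -/
abbrev L2 : Type _ := UniformSpace.Completion τ.Xc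

/-! ### Rank one operators -/

/-- The linear map `Θ_{x,y} z = x (y|z)_R = x Φ(y^* z)` on `X_c`. -/
def thetaLin (x y : τ.Xc) : τ.Xc →ₗ[ℂ] τ.Xc where
  toFun z := τ.ofAc (τ.val x * expect G (star (τ.val y) * τ.val z))
    (mul_mem_Ac G (τ.val_mem x) (expect_mem_Ac G
      (mul_mem_Ac G (star_mem_Ac G (τ.val_mem y)) (τ.val_mem z))))
  map_add' z w := τ.val_injective (by
    have hm : ∀ z, star (τ.val y) * τ.val z ∈ Ac G :=
      fun z => mul_mem_Ac G (star_mem_Ac G (τ.val_mem y)) (τ.val_mem z)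
    simp only [val_ofAc, map_add, mul_add, expect_add G (hm z) (hm w)])
  map_smul' c z := τ.val_injective (by
    simp only [val_ofAc, map_smul, mul_smul_comm, expect_smul, RingHom.id_apply])

lemma ext_gauge {a : G.CStar} {c : ℂ} (h : HasWeightValue τ.toFun a c) (z : Circle) :
    HasWeightValue τ.toFun (gauge G z a) c := by
  obtain ⟨a₀, a₁, a₂, a₃, h0, h1, h2, h3, rfl, rfl⟩ := h
  have hp : ∀ b : PosCone G.CStar, 0 ≤ gauge G z b := fun b => map_nonneg _ b.2
  have hg : ∀ b : PosCone G.CStar, τ.toFun ⟨gauge G z b, hp b⟩ = τ.toFun b :=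
    fun b => τ.gauge_invariant z b _ rfl
  refine ⟨⟨_, hp a₀⟩, ⟨_, hp a₁⟩, ⟨_, hp a₂⟩, ⟨_, hp a₃⟩, ?_, ?_, ?_, ?_, ?_, ?_⟩
  · rwa [hg]
  · rwa [hg]
  · rwa [hg]
  · rwa [hg]
  · simp only [map_add, map_sub, map_smul]
  · rw [hg, hg, hg, hg]

lemma ext_eq_zero {a : G.CStar} {c : ℂ} (h : HasWeightValue τ.toFun a c) (k : ℤ) (hk : k ≠ 0)
    (ha : ∀ z : Circle, gauge G z a = ((z ^ k : Circle) : ℂ) • a) : c = 0 := by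
  have hk' : (k : ℝ) ≠ 0 := by exact_mod_cast hk
  have hz : (((Circle.exp (Real.pi / k)) ^ k : Circle) : ℂ) = -1 := by
    rw [Circle.coe_zpow, Circle.coe_exp, ← Complex.exp_int_mul, ← Complex.exp_pi_mul_I]
    congr 1
    push_cast
    have : (k : ℂ) ≠ 0 := by exact_mod_cast hk
    field_simp
  have h1 := τ.ext_gauge h (Circle.exp (Real.pi / k))
  rw [ha, hz] at h1
  have h2 := τ.isTrace.hasWeightValue_unique h1 (τ.isTrace.hasWeightValue_smul (-1) h)
  have : (2 : ℂ) * c = 0 := by linear_combination h2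
  simpa using this

/-- The expectation on `X_c`. -/
def expectXc : τ.Xc →ₗ[ℂ] τ.Xc where
  toFun z := τ.ofAc (expect G (τ.val z)) (expect_mem_Ac G (τ.val_mem z))
  map_add' z w := τ.val_injective (by
    simp only [val_ofAc, map_add, expect_add G (τ.val_mem z) (τ.val_mem w)])
  map_smul' c z := τ.val_injective (by
    simp only [val_ofAc, map_smul, expect_smul, RingHom.id_apply])

lemma Xc_induction {P : τ.Xc → Prop}
    (hgen : ∀ μ ν : G.FinPath, P (τ.ofAc _ (path_mul_star_mem G μ ν)))
    (h0 : P 0) (hadd : ∀ x y, P x → P y → P (x + y)) (hsmul : ∀ (c : ℂ) x, P x → P (c • x))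
    (x : τ.Xc) : P x := by
  have : ∀ a (ha : a ∈ Ac G), P (τ.ofAc a ha) := by
    intro a ha
    induction ha using Submodule.span_induction with
    | mem x hx =>
      obtain ⟨μ, ν, _, rfl⟩ := hx
      exact hgen μ ν
    | zero => exact h0
    | add x y hx' hy' hx hy => exact hadd _ _ hx hy
    | smul c x _ hx => exact hsmul c _ hx
  exact this (τ.val x) (τ.val_mem x)

lemma inner_expect (x y : τ.Xc) : inner ℂ (τ.expectXc x) y = inner ℂ x (τ.expectXc y) := by
  revert y
  refine τ.Xc_induction
    (P := fun x => ∀ y, inner ℂ (τ.expectXc x) y = inner ℂ x (τ.expectXc y)) ?_ ?_ ?_ ?_ x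
  · intro μ ν y
    refine τ.Xc_induction
      (P := fun y => inner ℂ (τ.expectXc (τ.ofAc _ (path_mul_star_mem G μ ν))) y =
        inner ℂ (τ.ofAc _ (path_mul_star_mem G μ ν)) (τ.expectXc y)) ?_ ?_ ?_ ?_ y
    · intro α β
      set x := τ.ofAc _ (path_mul_star_mem G μ ν)
      set y := τ.ofAc _ (path_mul_star_mem G α β)
      have hx : τ.expectXc x = if μ.length = ν.length then x else 0 := by
        refine τ.val_injective ((expect_gen G μ ν).trans ?_)
        split_ifs <;> simp [x]
      have hy : τ.expectXc y = if α.length = β.length then y else 0 := by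
        refine τ.val_injective ((expect_gen G α β).trans ?_)
        split_ifs <;> simp [y]
      have hxy : ((α.length : ℤ) - β.length) - ((μ.length : ℤ) - ν.length) ≠ 0 →
          inner ℂ x y = 0 := by
        intro hk
        refine τ.ext_eq_zero (τ.hasValue (τ.val_mem x) (τ.val_mem y)) _ hk fun z => ?_
        simp only [x, y, val_ofAc]
        rw [map_mul, map_star, gauge_gen, gauge_gen, star_smul, smul_mul_assoc, mul_smul_comm,
          smul_smul]
        congr 1
        rw [zpow_sub z ((α.length : ℤ) - β.length), Circle.coe_mul, Circle.coe_inv_eq_conj,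
          mul_comm]
        rfl
      rw [hx, hy]
      split_ifs with h1 h2 h2
      · rfl
      · rw [inner_zero_right]; exact hxy (by omega)
      · rw [inner_zero_left]; exact (hxy (by omega)).symm
      · rw [inner_zero_left, inner_zero_right]
    · simp
    · intro a b ha hb
      rw [map_add, inner_add_right, inner_add_right, ha, hb]
    · intro c a ha
      rw [map_smul, inner_smul_right, inner_smul_right, ha]
  · intro y; simp
  · intro a b ha hb y
    rw [map_add, inner_add_left, inner_add_left, ha, hb]
  · intro c a ha y
    rw [map_smul, inner_smul_left, inner_smul_left, ha]

lemma norm_expect_le (x : τ.Xc) : ‖τ.expectXc x‖ ≤ ‖x‖ := by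
  have h1 : τ.expectXc (τ.expectXc x) = τ.expectXc x :=
    τ.val_injective (expect_expect G (τ.val_mem x))
  have h2 : inner ℂ (τ.expectXc x) (τ.expectXc x) = inner ℂ x (τ.expectXc x) := by
    rw [τ.inner_expect, h1]
  have h3 : ‖τ.expectXc x‖ ^ 2 ≤ ‖x‖ * ‖τ.expectXc x‖ := by
    rw [← inner_self_eq_norm_sq (𝕜 := ℂ), h2]
    exact (RCLike.re_le_norm _).trans (norm_inner_le_norm _ _)
  by_contra hlt
  push Not at hlt
  nlinarith [norm_nonneg x, norm_nonneg (τ.expectXc x)]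

lemma norm_ofAc_mul_le (a : G.CStar) (ha : a ∈ Ac G) (x : τ.Xc) :
    ‖τ.ofAc (a * τ.val x) (mul_mem_Ac G ha (τ.val_mem x))‖ ≤ ‖a‖ * ‖x‖ := by
  have hn : ∀ y : τ.Xc, ‖y‖ ^ 2 =
      (τ.toFun ⟨star (τ.val y) * τ.val y, star_mul_self_nonneg _⟩).toReal := by
    intro y
    rw [← inner_self_eq_norm_sq (𝕜 := ℂ), inner_def, τ.hasValue_self (τ.val_mem y)]
    simp
  refine le_of_sq_le_sq ?_ (by positivity)
  rw [mul_pow, hn, hn]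
  have h := τ.isTrace.sq_mul_le a (τ.val x)
  have h2 := ENNReal.toReal_mono
    (ENNReal.mul_lt_top ENNReal.coe_lt_top (τ.sqFinite_Ac (τ.val_mem x))).ne h
  rw [ENNReal.toReal_mul] at h2
  simpa using h2

lemma norm_thetaLin_le (x y z : τ.Xc) :
    ‖τ.thetaLin x y z‖ ≤ ‖τ.val x‖ * ‖star (τ.val y)‖ * ‖z‖ := by
  have h1 := τ.norm_ofAc_mul_le _ (star_mem_Ac G (τ.val_mem y)) z
  have h2 := τ.norm_expect_le (τ.ofAc (star (τ.val y) * τ.val z)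
    (mul_mem_Ac G (star_mem_Ac G (τ.val_mem y)) (τ.val_mem z)))
  have h3 := τ.norm_ofAc_mul_le _ (τ.val_mem x) (τ.expectXc (τ.ofAc (star (τ.val y) * τ.val z)
    (mul_mem_Ac G (star_mem_Ac G (τ.val_mem y)) (τ.val_mem z))))
  calc _ ≤ _ := h3
    _ ≤ ‖τ.val x‖ * (‖star (τ.val y)‖ * ‖z‖) :=
      mul_le_mul_of_nonneg_left (h2.trans h1) (norm_nonneg _)
    _ = _ := (mul_assoc _ _ _).symm

/-- The bounded operator `Θ_{x,y}` on `L²(X, τ)`. -/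
def theta (x y : τ.Xc) : τ.L2 →L[ℂ] τ.L2 :=
  ((τ.thetaLin x y).mkContinuous (‖τ.val x‖ * ‖star (τ.val y)‖)
    (τ.norm_thetaLin_le x y)).completion

lemma theta_coe (x y z : τ.Xc) : τ.theta x y (z : τ.L2) = (τ.thetaLin x y z : τ.L2) := by
  simp [theta]

/-- `End^{00}_F(X_c)`, the finite rank endomorphisms of `X_c`, acting on `L²(X, τ)`: the linear span
of the operators `Θ_{x,y}`, `x, y ∈ X_c`. -/
def finiteRank : Submodule ℂ (τ.L2 →L[ℂ] τ.L2) :=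
  Submodule.span ℂ {T | ∃ x y : τ.Xc, T = τ.theta x y}

lemma inner_thetaLin (x y z w : τ.Xc) :
    inner ℂ (τ.thetaLin x y z) w = inner ℂ z (τ.thetaLin y x w) := by
  have hm : ∀ a b : τ.Xc, star (τ.val a) * τ.val b ∈ Ac G :=
    fun a b => mul_mem_Ac G (star_mem_Ac G (τ.val_mem a)) (τ.val_mem b)
  have key := τ.inner_expect (τ.ofAc _ (hm y z)) (τ.ofAc _ (hm x w))
  simp only [inner_def] at key ⊢
  simp only [thetaLin, expectXc, LinearMap.coe_mk, AddHom.coe_mk, val_ofAc, star_mul, star_star,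
    mul_assoc] at key ⊢
  exact key

lemma star_theta (x y : τ.Xc) : star (τ.theta x y) = τ.theta y x := by
  rw [ContinuousLinearMap.star_eq_adjoint]
  symm
  rw [ContinuousLinearMap.eq_adjoint_iff]
  intro a b
  induction a, b using UniformSpace.Completion.induction_on₂ with
  | hp => exact isClosed_eq (by fun_prop) (by fun_prop)
  | ih a b =>
    rw [theta_coe, theta_coe, UniformSpace.Completion.inner_coe, UniformSpace.Completion.inner_coe,
      inner_thetaLin]

lemma star_mem_finiteRank {T : τ.L2 →L[ℂ] τ.L2} (hT : T ∈ τ.finiteRank) :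
    star T ∈ τ.finiteRank := by
  induction hT using Submodule.span_induction with
  | mem T hT =>
    obtain ⟨x, y, rfl⟩ := hT
    exact Submodule.subset_span ⟨y, x, τ.star_theta x y⟩
  | zero => rw [star_zero]; exact zero_mem _
  | add x y _ _ hx hy => rw [star_add]; exact add_mem hx hy
  | smul c x _ hx => rw [star_smul]; exact Submodule.smul_mem _ _ hx

/-- The von Neumann algebra `N = (End^{00}_F(X_c))''`. -/
def vonNeumann : VonNeumannAlgebra τ.L2 where
  carrier := Set.centralizer (Set.centralizer (τ.finiteRank : Set (τ.L2 →L[ℂ] τ.L2)))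
  mul_mem' := Set.mul_mem_centralizer
  one_mem' := Set.one_mem_centralizer
  add_mem' := Set.add_mem_centralizer
  zero_mem' := Set.zero_mem_centralizer
  algebraMap_mem' r := by
    intro T _
    exact (Algebra.commutes r T).symm
  star_mem' {T} hT := by
    have hs : ∀ {U : τ.L2 →L[ℂ] τ.L2},
        U ∈ Set.centralizer (τ.finiteRank : Set (τ.L2 →L[ℂ] τ.L2)) →
        star U ∈ Set.centralizer (τ.finiteRank : Set (τ.L2 →L[ℂ] τ.L2)) := by
      intro U hU R hR
      have := congrArg star (hU (star R) (τ.star_mem_finiteRank hR))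
      simpa using this.symm
    intro U hU
    have := congrArg star (hT (star U) (hs hU))
    simpa using this.symm
  centralizer_centralizer' := by
    simp

/-! ### The functional on the von Neumann algebra -/

/-- The vector `S_μ` of `X_c`. -/
def pathVec (μ : G.FinPath) : τ.Xc := τ.ofAc (path G μ) (path_mem_Ac G μ)

/-- The vector `S_μ^*` of `X_c`. -/
def pathStarVec (μ : G.FinPath) : τ.Xc := τ.ofAc (star (path G μ)) (star_mem_Ac G (path_mem_Ac G μ))

/-- `ω_μ(T) = ⟨S_μ, T S_μ⟩ + |r(μ)|_{|μ|}⁻¹ ⟨S_μ^*, T S_μ^*⟩` for `|μ| ≠ 0`, and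
`ω_v(T) = ⟨p_v, T p_v⟩`. -/
def omega (μ : G.FinPath) (T : τ.L2 →L[ℂ] τ.L2) : ℂ :=
  if μ.length = 0 then inner ℂ (τ.pathVec μ : τ.L2) (T (τ.pathVec μ))
  else inner ℂ (τ.pathVec μ : τ.L2) (T (τ.pathVec μ)) +
    (1 / (G.numPaths μ.range μ.length : ℂ)) *
      inner ℂ (τ.pathStarVec μ : τ.L2) (T (τ.pathStarVec μ))

/-- `τ̃(T) = lim_L ∑_{μ ∈ L} ω_μ(T) ∈ [0, ∞]` for `T ∈ N₊`, the limit over the net of finite sets of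
paths. For `T ≥ 0` each `ω_μ(T)` is a nonnegative real number. -/
def tilde (T : PosCone τ.vonNeumann.toStarSubalgebra) : ℝ≥0∞ :=
  ∑' μ : G.FinPath, ENNReal.ofReal (τ.omega μ T.1.1).re

end GaugeTrace
end RowFiniteGraph

section VN

variable {H : Type*} [NormedAddCommGroup H] [InnerProductSpace ℂ H] [CompleteSpace H]

/-- `φ` is normal: it preserves least upper bounds of bounded increasing nets. -/
def IsNormalWeight (M : VonNeumannAlgebra H) (φ : PosCone M.toStarSubalgebra → ℝ≥0∞) : Prop :=
  ∀ (D : Set (PosCone M.toStarSubalgebra)) (T : PosCone M.toStarSubalgebra),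
    D.Nonempty → DirectedOn (· ≤ ·) D → IsLUB D T → φ T = ⨆ R ∈ D, φ R

/-- A trace `φ` on a von Neumann algebra is semifinite: below each nonzero `T ∈ M₊` there is a nonzero
`R ∈ M₊` with `φ(R) < ∞`. -/
def IsSemifiniteWeight (M : VonNeumannAlgebra H) (φ : PosCone M.toStarSubalgebra → ℝ≥0∞) : Prop :=
  ∀ T : PosCone M.toStarSubalgebra, T.1 ≠ 0 → ∃ R : PosCone M.toStarSubalgebra,
    R ≤ T ∧ R.1 ≠ 0 ∧ φ R < ⊤

end VN

end

/-! ### Monotone nets of operators, and Parseval's identity on a completion. -/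

section HilbertSpace

open Filter Topology

variable {H : Type*} [NormedAddCommGroup H] [InnerProductSpace ℂ H]

/-! Write ξᵢ for the vectors `frame i`: S_μ for every path μ, and |r(μ)|_{|μ|}^{-1/2} S_μ^* for |μ|
≠ 0. Then τ̃(T) = ∑ᵢ ⟨ξᵢ, T ξᵢ⟩, and the proof rests on the ξᵢ being a Parseval frame for the right
F-module X_c: ∑ᵢ Θ_{ξᵢ,ξᵢ} z = z for z ∈ X_c (`hasSum_thetaLin_frame`). On a generator S_α S_β^*
only the ξᵢ of gauge degree |α| - |β| can contribute. In degree ≥ 0 one term survives, μ being the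
initial segment of α of that length. In negative degree the paths μ of length |β| - |α| that end at
the source of α contribute equal shares, and the normalisation cancels their number.

Let C_x be the extension of z ↦ Φ(x^* z) to L² (`coeff`). Since ⟨h, Θ_{x,x} h⟩ = ‖C_x h‖², the frame
identity becomes ∑ᵢ ‖C_{ξᵢ} h‖² = ‖h‖² on all of L². Every T ∈ N commutes with right multiplication
by Φ(X_c), because each Θ_{x,y} does. So, formally, Φ(y^* T^* x) = Φ(x^* T y)^*, and as the trace τ
makes the involution isometric, ‖C_y T^* x‖ = ‖C_x T y‖ (`norm_coeff_adjoint`). With Parseval this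
gives ‖T x‖² = ∑ᵢ ‖C_x T^* ξᵢ‖² (`tsum_norm_coeff_apply_frame`).

Three facts follow. Taking x = ξⱼ, summing over j and interchanging the sums gives ∑ⱼ ‖T ξⱼ‖² = ∑ᵢ
‖T^* ξᵢ‖², the trace property. If T^* kills every ξᵢ then T = 0, which is faithfulness. For T = 1
the right side is τ̃(Θ_{x,x}), so τ̃(Θ_{x,x}) = ‖x‖², and polarization yields τ̃(Θ_{x,y}) = ⟨y, x⟩.

Normality holds because τ̃ is a sum of vector functionals, and a least upper bound in N of an
increasing net is its weak limit. For semifiniteness, below T = s² lies s P² s with P = Θ_{ξᵢ,ξᵢ} ≤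
1. It is nonzero for some i by Parseval, and has finite trace because τ̃(P) < ∞. -/

lemma inner_re_le_of_le {S T : H →L[ℂ] H} (h : S ≤ T) (x : H) :
    (inner ℂ x (S x)).re ≤ (inner ℂ x (T x)).re := by
  have := ((ContinuousLinearMap.le_def S T).1 h).re_inner_nonneg_right x
  simp only [sub_apply, inner_sub_right, map_sub] at this
  exact sub_nonneg.1 this

lemma inner_re_apply_nonneg {T : H →L[ℂ] H} (hT : 0 ≤ T) (x : H) :
    0 ≤ (inner ℂ x (T x)).re := by
  simpa using inner_re_le_of_le hT x

variable [CompleteSpace H]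

lemma le_of_inner_re_le {S T : H →L[ℂ] H} (hS : IsSelfAdjoint S) (hT : IsSelfAdjoint T)
    (h : ∀ x, (inner ℂ x (S x)).re ≤ (inner ℂ x (T x)).re) : S ≤ T := by
  rw [ContinuousLinearMap.le_def, ContinuousLinearMap.isPositive_def]
  refine ⟨ContinuousLinearMap.isSelfAdjoint_iff_isSymmetric.1 (hT.sub hS), fun x => ?_⟩
  rw [ContinuousLinearMap.reApplyInnerSelf_apply, inner_re_symm]
  simp only [sub_apply, inner_sub_right, map_sub]
  exact sub_nonneg.2 (h x)

/-- A bounded increasing net of positive operators converges weakly. -/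
theorem exists_weak_limit_of_directed (D : Set (H →L[ℂ] H)) (hne : D.Nonempty)
    (hD : DirectedOn (· ≤ ·) D) (h0 : ∀ R ∈ D, 0 ≤ R) (B : H →L[ℂ] H) (hB : ∀ R ∈ D, R ≤ B) :
    ∃ S : H →L[ℂ] H, ∀ x y : H,
      Tendsto (fun R : D => inner ℂ ((R : H →L[ℂ] H) x) y) atTop (𝓝 (inner ℂ (S x) y)) := by
  have : Nonempty D := hne.to_subtype
  have : IsDirectedOrder D := ⟨fun a b => by
    obtain ⟨c, hc, hac, hbc⟩ := hD a a.2 b b.2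
    exact ⟨⟨c, hc⟩, hac, hbc⟩⟩
  -- On the diagonal the net is real, increasing and bounded by ⟨x, B x⟩, so it converges.
  -- Polarization then handles the off-diagonal entries.
  have hdiag : ∀ x : H, ∃ c : ℂ, Tendsto (fun R : D => inner ℂ ((R : H →L[ℂ] H) x) x) atTop (𝓝 c) := by
    intro x
    have hmono : Monotone fun R : D => (inner ℂ x ((R : H →L[ℂ] H) x)).re :=
      fun a b hab => inner_re_le_of_le hab x
    have hbdd : BddAbove (Set.range fun R : D => (inner ℂ x ((R : H →L[ℂ] H) x)).re) :=
      ⟨(inner ℂ x (B x)).re, by rintro _ ⟨R, rfl⟩; exact inner_re_le_of_le (hB R R.2) x⟩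
    have h1 := tendsto_atTop_ciSup hmono hbdd
    refine ⟨_, ((Complex.continuous_ofReal.tendsto _).comp h1).congr fun R => ?_⟩
    have hp := (ContinuousLinearMap.nonneg_iff_isPositive (R : H →L[ℂ] H)).1 (h0 R R.2)
    have hre : inner ℂ ((R : H →L[ℂ] H) x) x = inner ℂ x ((R : H →L[ℂ] H) x) :=
      hp.isSymmetric x x
    have him : (starRingEnd ℂ) (inner ℂ x ((R : H →L[ℂ] H) x)) = inner ℂ x ((R : H →L[ℂ] H) x) := by
      rw [inner_conj_symm, hre]
    rw [hre]
    exact Complex.conj_eq_iff_re.1 him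
  have hex : ∀ x y : H, ∃ c : ℂ, Tendsto (fun R : D => inner ℂ ((R : H →L[ℂ] H) x) y) atTop (𝓝 c) := by
    intro x y
    obtain ⟨c0, k0⟩ := hdiag (y + x)
    obtain ⟨c1, k1⟩ := hdiag (y - x)
    obtain ⟨c2, k2⟩ := hdiag (y + Complex.I • x)
    obtain ⟨c3, k3⟩ := hdiag (y - Complex.I • x)
    refine ⟨_, ((((k0.sub k1).add (k2.const_mul Complex.I)).sub
      (k3.const_mul Complex.I)).div_const 4).congr fun R => ?_⟩
    exact (inner_map_polarization ((R : H →L[ℂ] H) : H →ₗ[ℂ] H) y x).symm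
  choose c hc using hex
  have hbound : ∀ x y, ‖c x y‖ ≤ ‖B‖ * ‖x‖ * ‖y‖ := by
    intro x y
    refine le_of_tendsto (hc x y).norm (Eventually.of_forall fun R => ?_)
    have hn : ‖(R : H →L[ℂ] H)‖ ≤ ‖B‖ := CStarAlgebra.norm_le_norm_of_nonneg_of_le (h0 R R.2) (hB R R.2)
    calc _ ≤ ‖(R : H →L[ℂ] H) x‖ * ‖y‖ := norm_inner_le_norm _ _
      _ ≤ ‖B‖ * ‖x‖ * ‖y‖ := by
        gcongr
        exact (R : H →L[ℂ] H).le_of_opNorm_le hn x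
  -- The limits form a sesquilinear form, bounded by ‖B‖ because 0 ≤ R ≤ B gives ‖R‖ ≤ ‖B‖. A
  -- bounded form is represented by an operator.
  let F : H →ₗ⋆[ℂ] H →ₗ[ℂ] ℂ := LinearMap.mk₂'ₛₗ (starRingEnd ℂ) (RingHom.id ℂ) c
    (fun x x' y => tendsto_nhds_unique (hc _ _)
      (((hc x y).add (hc x' y)).congr fun R => by simp))
    (fun r x y => tendsto_nhds_unique (hc _ _)
      (((hc x y).const_smul (starRingEnd ℂ r)).congr fun R => by simp [mul_comm]))
    (fun x y y' => tendsto_nhds_unique (hc _ _)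
      (((hc x y).add (hc x y')).congr fun R => by simp))
    (fun r x y => tendsto_nhds_unique (hc _ _)
      (((hc x y).const_smul r).congr fun R => by simp))
  refine ⟨InnerProductSpace.continuousLinearMapOfBilin (F.mkContinuous₂ ‖B‖ hbound), fun x y => ?_⟩
  rw [InnerProductSpace.continuousLinearMapOfBilin_apply]
  exact hc x y

/-- In a von Neumann algebra, the least upper bound of an increasing net of positive operators is its
weak limit. -/
theorem VonNeumannAlgebra.inner_isLUB (M : VonNeumannAlgebra H)
    (D : Set (PosCone M.toStarSubalgebra)) (T : PosCone M.toStarSubalgebra) (hne : D.Nonempty)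
    (hD : DirectedOn (· ≤ ·) D) (hT : IsLUB D T) (x : H) :
    IsLUB ((fun R : PosCone M.toStarSubalgebra => (inner ℂ x (R.1.1 x)).re) '' D)
      (inner ℂ x (T.1.1 x)).re := by
  have hpos : ∀ R : PosCone M.toStarSubalgebra, (0 : H →L[ℂ] H) ≤ R.1.1 := fun R => R.2
  obtain ⟨S, hS⟩ := exists_weak_limit_of_directed ((fun R => R.1.1) '' D) (hne.image _)
    (by
      rintro _ ⟨a, ha, rfl⟩ _ ⟨b, hb, rfl⟩
      obtain ⟨c, hc, hac, hbc⟩ := hD a ha b hb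
      exact ⟨_, ⟨c, hc, rfl⟩, hac, hbc⟩)
    (by rintro _ ⟨a, _, rfl⟩; exact hpos a) T.1.1
    (by rintro _ ⟨a, ha, rfl⟩; exact hT.1 ha)
  set D' : Set (H →L[ℂ] H) := (fun R : PosCone M.toStarSubalgebra => R.1.1) '' D
  have : Nonempty D' := (hne.image _).to_subtype
  have : IsDirectedOrder D' := ⟨by
    rintro ⟨_, a, ha, rfl⟩ ⟨_, b, hb, rfl⟩
    obtain ⟨c, hc, hac, hbc⟩ := hD a ha b hb
    exact ⟨⟨_, c, hc, rfl⟩, hac, hbc⟩⟩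
  have hsym : ∀ R : D', ∀ x y, inner ℂ ((R : H →L[ℂ] H) x) y = inner ℂ x ((R : H →L[ℂ] H) y) := by
    rintro ⟨_, a, ha, rfl⟩ x y
    exact ((ContinuousLinearMap.nonneg_iff_isPositive _).1 (hpos a)).isSymmetric x y
  have hre : ∀ x, Tendsto (fun R : D' => (inner ℂ x ((R : H →L[ℂ] H) x)).re) atTop
      (𝓝 (inner ℂ x (S x)).re) := by
    intro x
    have := (Complex.continuous_re.tendsto _).comp (hS x x)
    rw [show (inner ℂ (S x) x).re = (inner ℂ x (S x)).re from inner_re_symm (𝕜 := ℂ) _ _] at this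
    refine this.congr fun R => ?_
    rw [Function.comp, hsym]
  have hmono : ∀ x, Monotone fun R : D' => (inner ℂ x ((R : H →L[ℂ] H) x)).re :=
    fun x a b hab => inner_re_le_of_le hab x
  have hge : ∀ R : D', ∀ x, (inner ℂ x ((R : H →L[ℂ] H) x)).re ≤ (inner ℂ x (S x)).re :=
    fun R x => (hmono x).ge_of_tendsto (hre x) R
  have hSsa : IsSelfAdjoint S := by
    rw [ContinuousLinearMap.isSelfAdjoint_iff_isSymmetric]
    intro x y
    refine tendsto_nhds_unique (hS x y) ?_
    have := (Complex.continuous_conj.tendsto _).comp (hS y x)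
    rw [inner_conj_symm] at this
    refine this.congr fun R => ?_
    rw [Function.comp, inner_conj_symm, hsym]
  have hRS : ∀ R : D', (R : H →L[ℂ] H) ≤ S := by
    intro R
    refine le_of_inner_re_le ?_ hSsa (hge R)
    obtain ⟨_, a, ha, rfl⟩ := R
    exact IsSelfAdjoint.of_nonneg (hpos a)
  have hS0 : 0 ≤ S := by
    obtain ⟨a, ha⟩ := hne
    exact (hpos a).trans (hRS ⟨_, a, ha, rfl⟩)
  -- Commutation with a fixed operator survives weak limits, so S lies in the bicommutant M. This is
  -- needed because T is a least upper bound only among elements of M.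
  have hSM : S ∈ M := by
    rw [← M.commutant_commutant, VonNeumannAlgebra.mem_commutant_iff]
    intro U hU
    rw [VonNeumannAlgebra.mem_commutant_iff] at hU
    refine ContinuousLinearMap.ext fun x => ext_inner_right ℂ fun y => ?_
    have h1 := hS (U x) y
    have h2 := hS x (ContinuousLinearMap.adjoint U y)
    rw [ContinuousLinearMap.adjoint_inner_right] at h2
    refine tendsto_nhds_unique h2 (h1.congr fun R => ?_)
    obtain ⟨_, a, ha, rfl⟩ := R
    rw [ContinuousLinearMap.adjoint_inner_right]
    exact congrArg (fun W : H →L[ℂ] H => inner ℂ (W x) y) (hU a.1.1 a.1.2)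
  have hTS : T.1.1 ≤ S :=
    have hub : (⟨⟨S, hSM⟩, hS0⟩ : PosCone M.toStarSubalgebra) ∈ upperBounds D :=
      fun a ha => hRS ⟨_, a, ha, rfl⟩
    hT.2 hub
  refine ⟨?_, fun b hb => ?_⟩
  · rintro _ ⟨a, ha, rfl⟩
    exact inner_re_le_of_le (hT.1 ha) x
  · refine (inner_re_le_of_le hTS x).trans (le_of_tendsto (hre x) (Eventually.of_forall ?_))
    rintro ⟨_, a, ha, rfl⟩
    exact hb ⟨a, ha, rfl⟩

/-- Parseval's identity for a family of operators extends from a space to its completion. -/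
theorem hasSum_norm_sq_of_dense {X ι : Type*} [NormedAddCommGroup X] [InnerProductSpace ℂ X]
    (A : ι → UniformSpace.Completion X →L[ℂ] UniformSpace.Completion X)
    (h : ∀ x : X, HasSum (fun i => ‖A i (x : UniformSpace.Completion X)‖ ^ 2) (‖x‖ ^ 2))
    (x : UniformSpace.Completion X) : HasSum (fun i => ‖A i x‖ ^ 2) (‖x‖ ^ 2) := by
  have hfin : ∀ (s : Finset ι) (x : UniformSpace.Completion X),
      ∑ i ∈ s, ‖A i x‖ ^ 2 ≤ ‖x‖ ^ 2 := by
    intro s x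
    induction x using UniformSpace.Completion.induction_on with
    | hp => exact isClosed_le (by fun_prop) (by fun_prop)
    | ih x =>
      rw [UniformSpace.Completion.norm_coe]
      exact sum_le_hasSum s (fun _ _ => by positivity) (h x)
  have hmem : ∀ x : UniformSpace.Completion X,
      Memℓp (fun i => A i x) 2 := fun x => by
    refine memℓp_gen (summable_of_sum_le (fun i => by positivity) (c := ‖x‖ ^ 2) fun s => ?_)
    simpa using hfin s x
  -- The bounds on finite sums pass to the completion as closed conditions, but equality of the
  -- infinite sum does not. Collecting the `A i x` into one contraction W to ℓ² makes `‖W x‖ = ‖x‖`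
  -- a closed condition.
  let W : UniformSpace.Completion X →ₗ[ℂ] lp (fun _ : ι => UniformSpace.Completion X) 2 :=
    { toFun := fun x => ⟨fun i => A i x, hmem x⟩
      map_add' := fun x y => by ext i; exact map_add (A i) x y
      map_smul' := fun c x => by ext i; exact map_smul (A i) c x }
  have hW : ∀ x, HasSum (fun i => ‖A i x‖ ^ 2) (‖W x‖ ^ 2) := fun x => by
    have := lp.hasSum_norm (p := 2) (by norm_num) (W x)
    simp only [ENNReal.toReal_ofNat, Real.rpow_ofNat] at this
    exact this
  have hWle : ∀ x, ‖W x‖ ≤ 1 * ‖x‖ := fun x => by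
    rw [one_mul]
    refine le_of_sq_le_sq ?_ (norm_nonneg _)
    exact hasSum_le_of_sum_le (hW x) fun s => hfin s x
  have hWc : Continuous W := (W.mkContinuous 1 hWle).continuous
  have hWn : ‖W x‖ = ‖x‖ := by
    induction x using UniformSpace.Completion.induction_on with
    | hp => exact isClosed_eq (by fun_prop) (by fun_prop)
    | ih x =>
      have := (hW x).unique (h x)
      rw [UniformSpace.Completion.norm_coe]
      exact (sq_eq_sq₀ (norm_nonneg _) (norm_nonneg _)).1 this
  rw [← hWn]
  exact hW x

end HilbertSpace

namespace RowFiniteGraph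

variable {V : Type u} {E : Type v} {G : RowFiniteGraph V E}

/-! ### Counting paths -/

lemma FinPath.ext_edges {μ ν : G.FinPath} (hs : μ.source = ν.source) (he : μ.edges = ν.edges) :
    μ = ν := by
  cases μ; cases ν; simp_all

lemma finite_paths_to (hfin : G.LocallyFinite) (v : V) (k : ℕ) :
    {μ : G.FinPath | μ.length = k ∧ μ.range = v}.Finite := by
  induction k with
  | zero =>
    refine (Set.finite_singleton (⟨v, [], trivial⟩ : G.FinPath)).subset ?_
    rintro ⟨w, l, hl⟩ ⟨h1, h2⟩
    obtain rfl : l = [] := List.length_eq_zero_iff.1 h1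
    obtain rfl : w = v := h2
    rfl
  | succ k ih =>
    -- A path of length k + 1 is an edge prepended to a path of length k. Counting the pairs
    -- (source, edges) avoids proving that each prepended list is a path.
    have hU := ih.biUnion fun ν _ => (hfin ν.source).image fun e => (G.src e, e :: ν.edges)
    refine Set.Finite.of_finite_image (f := fun μ : G.FinPath => (μ.source, μ.edges))
      (hU.subset ?_) ?_
    · rintro _ ⟨⟨w, l, hl⟩, ⟨h1, h2⟩, rfl⟩
      cases l with
      | nil => simp [FinPath.length] at h1
      | cons e l =>
        obtain ⟨rfl, hl⟩ := hl
        refine Set.mem_biUnion (x := (⟨G.rng e, l, hl⟩ : G.FinPath)) ⟨?_, h2⟩ ⟨e, rfl, rfl⟩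
        simpa [FinPath.length] using h1
    · intro μ _ ν _ h
      exact FinPath.ext_edges (congrArg Prod.fst h) (congrArg Prod.snd h)

lemma exists_path_to (hsrc : G.NoSources) (v : V) (k : ℕ) :
    ∃ μ : G.FinPath, μ.length = k ∧ μ.range = v := by
  induction k with
  | zero => exact ⟨⟨v, [], trivial⟩, rfl, rfl⟩
  | succ k ih =>
    obtain ⟨ν, h1, h2⟩ := ih
    obtain ⟨e, he⟩ := hsrc ν.source
    refine ⟨⟨G.src e, e :: ν.edges, rfl, by rw [he]; exact ν.isPath⟩, ?_, ?_⟩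
    · simpa [FinPath.length] using h1
    · change G.rangeFrom (G.rng e) ν.edges = v
      rw [he]
      exact h2

lemma numPaths_eq_card (hfin : G.LocallyFinite) (v : V) (k : ℕ) :
    G.numPaths v k = (finite_paths_to hfin v k).toFinset.card := by
  rw [← Set.ncard_eq_toFinset_card _ (finite_paths_to hfin v k)]
  rfl

/-- Without sources a path can be prolonged backwards indefinitely. Hence the factor 1/|v|_k is a
true inverse, never the default value of division by zero. -/
lemma numPaths_ne_zero (hfin : G.LocallyFinite) (hsrc : G.NoSources) (v : V) (k : ℕ) :
    G.numPaths v k ≠ 0 := by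
  obtain ⟨μ, hμ⟩ := exists_path_to hsrc v k
  rw [numPaths_eq_card hfin]
  exact Finset.card_ne_zero_of_mem (a := μ) (by simpa using hμ)

lemma isPathFrom_append {v : V} {l m : List E} :
    G.IsPathFrom v (l ++ m) ↔ G.IsPathFrom v l ∧ G.IsPathFrom (G.rangeFrom v l) m := by
  induction l generalizing v with
  | nil => simp [IsPathFrom, rangeFrom]
  | cons e l ih => simp [IsPathFrom, rangeFrom, ih, and_assoc]

namespace CStar

variable (G)

/-! ### Homogeneous elements -/

/-- `a` lies in the spectral subspace of degree `k` of the gauge action. -/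
def IsHomogeneous (k : ℤ) (a : G.CStar) : Prop :=
  ∀ z : Circle, gauge G z a = ((z ^ k : Circle) : ℂ) • a

variable {G}

lemma IsHomogeneous.mul {k m : ℤ} {a b : G.CStar} (ha : IsHomogeneous G k a)
    (hb : IsHomogeneous G m b) : IsHomogeneous G (k + m) (a * b) := fun z => by
  rw [map_mul, ha z, hb z, zpow_add, Circle.coe_mul, smul_mul_assoc, mul_smul_comm, smul_smul]

lemma IsHomogeneous.star {k : ℤ} {a : G.CStar} (ha : IsHomogeneous G k a) :
    IsHomogeneous G (-k) (star a) := fun z => by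
  rw [map_star, ha z, star_smul, zpow_neg, Circle.coe_inv_eq_conj]
  rfl

lemma isHomogeneous_path (μ : G.FinPath) : IsHomogeneous G μ.length (path G μ) := fun z => by
  rw [path, gauge_word, zpow_natCast, Circle.coe_pow]
  rfl

lemma isHomogeneous_path_mul_star (μ ν : G.FinPath) :
    IsHomogeneous G ((μ.length : ℤ) - ν.length) (path G μ * star (path G ν)) :=
  (isHomogeneous_path μ).mul (isHomogeneous_path ν).star

/-- The average of z^k over the circle vanishes unless k = 0. Evaluating Φ on products of generators
thereby becomes a comparison of degrees. -/
lemma IsHomogeneous.expect_eq {k : ℤ} {a : G.CStar} (ha : IsHomogeneous G k a) :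
    expect G a = if k = 0 then a else 0 := by
  simp only [expect, fun θ : ℝ => ha (Circle.exp θ)]
  rw [intervalIntegral.integral_smul_const]
  split_ifs with h
  · subst h
    simp only [zpow_zero, Circle.coe_one, intervalIntegral.integral_const, sub_zero]
    rw [smul_assoc, one_smul, smul_smul, inv_mul_cancel₀ (by positivity), one_smul]
  · rw [integral_exp_zpow _ h, zero_smul, smul_zero]

/-! ### Products of paths -/

lemma star_word_mul_word {v : V} {l : List E} (h : G.IsPathFrom v l) :
    star (word G v l) * word G v l = p G (G.rangeFrom v l) := by
  induction l generalizing v with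
  | nil => simp only [word, rangeFrom, p_star, p_sq]
  | cons e l ih =>
    simp only [word, rangeFrom, star_mul]
    rw [mul_assoc, ← mul_assoc (star (S G e)), star_S_mul_S, p_mul_word G _ _ h.2, ih h.2]

/-- Common first edges cancel. Either two distinct edges meet, and their range projections are
orthogonal, or both lists run out at distinct vertices. The sources enter the last hypothesis
because empty lists at different vertices are different paths. -/
lemma star_word_mul_word_of_ne {v w : V} {l m : List E} (hl : G.IsPathFrom v l)
    (hm : G.IsPathFrom w m) (hlen : l.length = m.length) (hne : v = w → l ≠ m) :
    star (word G v l) * word G w m = 0 := by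
  induction l generalizing v w m with
  | nil =>
    obtain rfl : m = [] := List.length_eq_zero_iff.1 hlen.symm
    simp only [word, p_star]
    exact p_orth G fun h => hne h rfl
  | cons e l ih =>
    cases m with
    | nil => simp at hlen
    | cons f m =>
      simp only [word, star_mul]
      rw [mul_assoc, ← mul_assoc (star (S G e))]
      by_cases hef : e = f
      · subst hef
        rw [star_S_mul_S, p_mul_word G _ _ hm.2]
        refine ih hl.2 hm.2 (by simpa using hlen) fun _ hlm => ?_
        exact hne (hl.1.symm.trans hm.1) (by rw [hlm])
      · rw [star_S_mul_S_of_ne G hef, zero_mul, mul_zero]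

lemma word_append {v : V} {l m : List E} (h : G.IsPathFrom (G.rangeFrom v l) m) :
    word G v (l ++ m) = word G v l * word G (G.rangeFrom v l) m := by
  induction l generalizing v with
  | nil => exact (p_mul_word G _ _ h).symm
  | cons e l ih =>
    simp only [List.cons_append, word, rangeFrom, mul_assoc]
    rw [ih h]

/-- The initial segment of length `k` of a path. -/
def _root_.RowFiniteGraph.FinPath.take (α : G.FinPath) (k : ℕ) : G.FinPath where
  source := α.source
  edges := α.edges.take k
  isPath := (isPathFrom_append (m := α.edges.drop k)).1
    (by rw [List.take_append_drop]; exact α.isPath) |>.1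

lemma _root_.RowFiniteGraph.FinPath.length_take {α : G.FinPath} {k : ℕ} (h : k ≤ α.length) :
    (α.take k).length = k := by
  simpa [FinPath.take, FinPath.length] using h

lemma exists_path_eq_take_mul (α : G.FinPath) (k : ℕ) :
    ∃ b : G.CStar, path G α = path G (α.take k) * b := by
  have h := (isPathFrom_append (G := G) (v := α.source) (l := α.edges.take k)
    (m := α.edges.drop k)).1 (by rw [List.take_append_drop]; exact α.isPath)
  refine ⟨word G (G.rangeFrom α.source (α.edges.take k)) (α.edges.drop k), ?_⟩
  have := word_append h.2
  rw [List.take_append_drop] at this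
  exact this

/-- The projection S_μ S_μ^* of an initial segment μ of α fixes S_α. This gives the one surviving
term of the frame expansion in nonnegative degree. -/
lemma path_take_mul_star_mul (α : G.FinPath) (k : ℕ) :
    path G (α.take k) * (star (path G (α.take k)) * path G α) = path G α := by
  obtain ⟨b, hb⟩ := exists_path_eq_take_mul α k
  rw [hb, ← mul_assoc (star _), path, star_word_mul_word (α.take k).isPath, ← mul_assoc,
    word_mul_p]

lemma star_path_mul_path_of_ne {μ α : G.FinPath} {k : ℕ} (hμ : μ.length = k) (hα : k ≤ α.length)
    (h : μ ≠ α.take k) : star (path G μ) * path G α = 0 := by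
  obtain ⟨b, hb⟩ := exists_path_eq_take_mul α k
  rw [hb, ← mul_assoc, path, path, star_word_mul_word_of_ne μ.isPath (α.take k).isPath
    (hμ.trans (FinPath.length_take hα).symm) (fun h1 h2 => h (FinPath.ext_edges h1 h2)), zero_mul]

lemma p_mul_path (v : V) (α : G.FinPath) [Decidable (v = α.source)] :
    p G v * path G α = if v = α.source then path G α else 0 := by
  have h := p_mul_word G α.source α.edges α.isPath
  split_ifs with hv
  · rw [hv]; exact h
  · rw [path, ← h, ← mul_assoc, p_orth G hv, zero_mul]

end CStar

namespace GaugeTrace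

open CStar

variable (τ : G.GaugeTrace)

/-! ### The frame -/

/-- The vectors `S_μ`, and `|r(μ)|_{|μ|}^{-1/2} S_μ^*` for `|μ| ≠ 0`. -/
noncomputable def frame : G.FinPath ⊕ G.FinPath → τ.Xc
  | .inl μ => τ.pathVec μ
  -- A vertex projection is self-adjoint and already occurs on the left, so the zero vector prevents
  -- counting it twice.
  | .inr μ => if μ.length = 0 then 0 else
      (((√(G.numPaths μ.range μ.length))⁻¹ : ℝ) : ℂ) • τ.pathStarVec μ

lemma val_thetaLin (x y z : τ.Xc) :
    τ.val (τ.thetaLin x y z) = τ.val x * expect G (star (τ.val y) * τ.val z) := rfl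

lemma thetaLin_smul_smul (c : ℝ) (x z : τ.Xc) :
    τ.thetaLin ((c : ℂ) • x) ((c : ℂ) • x) z = ((c ^ 2 : ℝ) : ℂ) • τ.thetaLin x x z := by
  refine τ.val_injective ?_
  rw [map_smul, val_thetaLin, val_thetaLin, map_smul, star_smul, smul_mul_assoc, smul_mul_assoc,
    expect_smul, mul_smul_comm, smul_smul]
  congr 1
  rw [Complex.star_def, Complex.conj_ofReal]
  push_cast
  ring

lemma thetaLin_zero_left (y z : τ.Xc) : τ.thetaLin 0 y z = 0 :=
  τ.val_injective (by rw [val_thetaLin, map_zero, zero_mul])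

/-- The element x^* z has degree m - k, so Φ either keeps it or kills it. -/
lemma thetaLin_of_isHomogeneous {x z : τ.Xc} {k m : ℤ} (hx : IsHomogeneous G k (τ.val x))
    (hz : IsHomogeneous G m (τ.val z)) :
    τ.val (τ.thetaLin x x z) =
      if k = m then τ.val x * (star (τ.val x) * τ.val z) else 0 := by
  rw [val_thetaLin, (hx.star.mul hz).expect_eq]
  by_cases h : k = m
  · rw [if_pos h, if_pos (by omega)]
  · rw [if_neg h, if_neg (by omega), mul_zero]

/-- On S_α S_β^* of degree d = |α| - |β| the sum has finitely many nonzero terms. For d ≥ 0 the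
projections S_μ S_μ^* with |μ| = d are mutually orthogonal, and only one meets S_α. For d < 0 the
products S_μ^* S_μ = p_{r(μ)} act as the identity exactly when r(μ) is the source of α, and the
weights average these terms. -/
lemma hasSum_thetaLin_frame_gen (hfin : G.LocallyFinite) (hsrc : G.NoSources) (α β : G.FinPath) :
    HasSum (fun i => τ.thetaLin (τ.frame i) (τ.frame i) (τ.ofAc _ (path_mul_star_mem G α β)))
      (τ.ofAc _ (path_mul_star_mem G α β)) := by
  classical
  set z := τ.ofAc _ (path_mul_star_mem G α β)
  have hz : IsHomogeneous G ((α.length : ℤ) - β.length) (τ.val z) :=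
    isHomogeneous_path_mul_star α β
  have hl : ∀ μ : G.FinPath, τ.val (τ.thetaLin (τ.frame (.inl μ)) (τ.frame (.inl μ)) z) =
      if (μ.length : ℤ) = (α.length : ℤ) - β.length then
        path G μ * (star (path G μ) * path G α) * star (path G β) else 0 := by
    intro μ
    refine (τ.thetaLin_of_isHomogeneous (x := τ.pathVec μ) (isHomogeneous_path μ) hz).trans ?_
    simp only [z, val_ofAc, pathVec, mul_assoc]
  have hr : ∀ μ : G.FinPath, τ.thetaLin (τ.frame (.inr μ)) (τ.frame (.inr μ)) z =
      if μ.length ≠ 0 ∧ -(μ.length : ℤ) = (α.length : ℤ) - β.length ∧ μ.range = α.source then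
        ((G.numPaths μ.range μ.length : ℂ))⁻¹ • z else 0 := by
    intro μ
    by_cases h0 : μ.length = 0
    · rw [if_neg (by simp [h0]), frame, if_pos h0, thetaLin_zero_left]
    · rw [frame, if_neg h0, thetaLin_smul_smul, inv_pow, Real.sq_sqrt (Nat.cast_nonneg _)]
      push_cast
      have hv : τ.val (τ.thetaLin (τ.pathStarVec μ) (τ.pathStarVec μ) z) =
          if -(μ.length : ℤ) = (α.length : ℤ) - β.length ∧ μ.range = α.source then
            τ.val z else 0 := by
        rw [τ.thetaLin_of_isHomogeneous (x := τ.pathStarVec μ) (isHomogeneous_path μ).star hz]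
        simp only [z, val_ofAc, pathStarVec, star_star]
        rw [← mul_assoc, path, star_word_mul_word μ.isPath, ← mul_assoc, p_mul_path]
        change (if _ then (if μ.range = α.source then _ else _) * _ else _) = _
        split_ifs <;> simp_all
      by_cases h : -(μ.length : ℤ) = (α.length : ℤ) - β.length ∧ μ.range = α.source
      · rw [if_pos ⟨h0, h⟩]
        rw [if_pos h] at hv
        rw [τ.val_injective hv]
      · rw [if_neg fun h' => h h'.2]
        rw [if_neg h] at hv
        rw [τ.val_injective (hv.trans (map_zero _).symm), smul_zero]
  rcases le_or_gt β.length α.length with hd | hd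
  · have hk : α.length - β.length ≤ α.length := Nat.sub_le _ _
    -- The only path of length |α| - |β| whose range projection meets S_α is the initial segment of
    -- α.
    have hval : τ.thetaLin (τ.frame (.inl (α.take (α.length - β.length))))
        (τ.frame (.inl (α.take (α.length - β.length)))) z = z := by
      refine τ.val_injective ?_
      rw [hl, if_pos (by rw [FinPath.length_take hk]; omega), path_take_mul_star_mul]
      rfl
    have hsum := hasSum_single (f := fun i => τ.thetaLin (τ.frame i) (τ.frame i) z)
      (Sum.inl (α.take (α.length - β.length))) ?_
    · rwa [hval] at hsum
    rintro (μ | μ) hμ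
    · refine τ.val_injective ?_
      rw [hl, map_zero]
      split_ifs with h
      · rw [star_path_mul_path_of_ne (k := α.length - β.length) (by omega) hk
          (fun h' => hμ (by rw [h'])), mul_zero, zero_mul]
      · rfl
    · rw [hr, if_neg]
      rintro ⟨h0, h1, _⟩
      omega
  · set k := β.length - α.length
    set s := (finite_paths_to hfin α.source k).toFinset
    have hs : ∀ μ, μ ∈ s ↔ μ.length = k ∧ μ.range = α.source := fun μ => by simp [s]
    -- Each of the |s(α)|_k paths μ in `s` contributes z divided by |s(α)|_k.
    have hsum : ∑ i ∈ s.map Function.Embedding.inr,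
        τ.thetaLin (τ.frame i) (τ.frame i) z = z := by
      rw [Finset.sum_map, Finset.sum_congr rfl (g := fun _ =>
        ((G.numPaths α.source k : ℂ))⁻¹ • z)]
      · rw [Finset.sum_const, ← numPaths_eq_card hfin, ← Nat.cast_smul_eq_nsmul ℂ, smul_smul,
          mul_inv_cancel₀ (Nat.cast_ne_zero.2 (numPaths_ne_zero hfin hsrc _ _)), one_smul]
      · intro μ hμ
        obtain ⟨h1, h2⟩ := (hs μ).1 hμ
        rw [Function.Embedding.inr_apply, hr, if_pos ⟨by omega, by omega, h2⟩, h1, h2]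
    have := hasSum_sum_of_ne_finset_zero (L := SummationFilter.unconditional _)
      (f := fun i => τ.thetaLin (τ.frame i) (τ.frame i) z)
      (s := s.map Function.Embedding.inr) ?_
    · rwa [hsum] at this
    · rintro (μ | μ) hμ
      · refine τ.val_injective ?_
        rw [hl, if_neg (by omega), map_zero]
      · rw [hr, if_neg]
        rintro ⟨h0, h1, h2⟩
        refine hμ (Finset.mem_map.2 ⟨μ, (hs μ).2 ⟨by omega, h2⟩, rfl⟩)

/-- `∑ᵢ Θ_{ξᵢ,ξᵢ} = 1` on `X_c`. -/
theorem hasSum_thetaLin_frame (hfin : G.LocallyFinite) (hsrc : G.NoSources) (z : τ.Xc) :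
    HasSum (fun i => τ.thetaLin (τ.frame i) (τ.frame i) z) z := by
  refine τ.Xc_induction (P := fun z => HasSum (fun i => τ.thetaLin (τ.frame i) (τ.frame i) z) z)
    (τ.hasSum_thetaLin_frame_gen hfin hsrc) ?_ ?_ ?_ z
  · simp
  · intro x y hx hy
    simpa using hx.add hy
  · intro c x hx
    simpa using hx.const_smul c

end GaugeTrace
end RowFiniteGraph

/-! ### The expectation as a module map, and the frame coefficients on L². -/

namespace RowFiniteGraph

variable {V : Type u} {E : Type v} {G : RowFiniteGraph V E}

namespace CStar

lemma expect_star {a : G.CStar} (ha : a ∈ Ac G) : expect G (star a) = star (expect G a) := by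
  induction ha using Submodule.span_induction with
  | mem x hx =>
    obtain ⟨μ, ν, _, rfl⟩ := hx
    have h := isHomogeneous_path_mul_star μ ν
    rw [h.expect_eq, h.star.expect_eq]
    simp only [neg_eq_zero]
    split_ifs <;> simp
  | zero => simp [expect_zero]
  | add x y hx' hy' hx hy =>
    rw [star_add, expect_add G (star_mem_Ac G hx') (star_mem_Ac G hy'), hx, hy,
      expect_add G hx' hy', star_add]
  | smul c x _ hx => rw [star_smul, expect_smul, expect_smul, hx, star_smul]

/-- `Φ` is a right module map over its image. -/
lemma expect_mul_expect {a b : G.CStar} (ha : a ∈ Ac G) (hb : b ∈ Ac G) :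
    expect G (a * expect G b) = expect G a * expect G b := by
  induction hb using Submodule.span_induction with
  | mem x hx =>
    obtain ⟨α, β, _, rfl⟩ := hx
    have hx' := path_mul_star_mem G α β
    have hx := isHomogeneous_path_mul_star α β
    rw [hx.expect_eq]
    split_ifs with h0
    · rw [h0] at hx
      induction ha using Submodule.span_induction with
      | mem y hy =>
        obtain ⟨μ, ν, _, rfl⟩ := hy
        have hy := isHomogeneous_path_mul_star μ ν
        rw [hy.expect_eq, (hy.mul hx).expect_eq, add_zero]
        split_ifs <;> simp
      | zero => simp [expect_zero]
      | add y z hy' hz' hy hz =>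
        rw [add_mul, expect_add G (mul_mem_Ac G hy' hx') (mul_mem_Ac G hz' hx'), hy, hz,
          expect_add G hy' hz', add_mul]
      | smul c y _ hy => rw [smul_mul_assoc, expect_smul, expect_smul, hy, smul_mul_assoc]
    · rw [mul_zero, mul_zero, expect_zero]
  | zero => simp [expect_zero]
  | add y z hy' hz' hy hz =>
    rw [expect_add G hy' hz', mul_add, expect_add G (mul_mem_Ac G ha (expect_mem_Ac G hy'))
      (mul_mem_Ac G ha (expect_mem_Ac G hz')), hy, hz, mul_add]
  | smul c y _ hy => rw [expect_smul, mul_smul_comm, expect_smul, hy, mul_smul_comm]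

end CStar

namespace GaugeTrace

open CStar IsTrace

variable (τ : G.GaugeTrace)

/-! ### The involution and right multiplication -/

/-- The adjoint `x^*` of `x ∈ X_c`. -/
noncomputable def starXc (x : τ.Xc) : τ.Xc := τ.ofAc (star (τ.val x)) (star_mem_Ac G (τ.val_mem x))

/-- The product of two elements of `X_c`. -/
noncomputable def mulXc (x y : τ.Xc) : τ.Xc := τ.ofAc (τ.val x * τ.val y) (mul_mem_Ac G (τ.val_mem x) (τ.val_mem y))

@[simp] lemma val_starXc (x : τ.Xc) : τ.val (τ.starXc x) = star (τ.val x) := rfl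

@[simp] lemma val_mulXc (x y : τ.Xc) : τ.val (τ.mulXc x y) = τ.val x * τ.val y := rfl

@[simp] lemma val_expectXc (x : τ.Xc) : τ.val (τ.expectXc x) = expect G (τ.val x) := rfl

lemma norm_sq_eq (x : τ.Xc) :
    ‖x‖ ^ 2 = (τ.toFun ⟨star (τ.val x) * τ.val x, star_mul_self_nonneg _⟩).toReal := by
  rw [← inner_self_eq_norm_sq (𝕜 := ℂ), inner_def, τ.hasValue_self (τ.val_mem x)]
  simp

/-- This is the trace property τ(x^* x) = τ(x x^*) in Hilbert space form. -/
lemma norm_starXc (x : τ.Xc) : ‖τ.starXc x‖ = ‖x‖ := by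
  refine (sq_eq_sq₀ (norm_nonneg _) (norm_nonneg _)).1 ?_
  rw [norm_sq_eq, norm_sq_eq]
  congr 1
  exact (τ.isTrace.tracial (τ.val x) _ _ rfl (by simp)).symm

/-- The statement amounts to τ(y x^*) = τ(x^* y) for the linear extension. Traciality is assumed
only for squares, so the general case comes from isometry of the involution by polarization. -/
lemma inner_starXc (x y : τ.Xc) : inner ℂ (τ.starXc y) (τ.starXc x) = inner ℂ x y := by
  have h1 : ‖τ.starXc y + τ.starXc x‖ = ‖x + y‖ := by
    rw [← τ.norm_starXc (x + y)]
    congr 1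
    exact τ.val_injective (by simp [add_comm])
  have h2 : ‖τ.starXc y - τ.starXc x‖ = ‖x - y‖ := by
    rw [← τ.norm_starXc (x - y), ← norm_neg]
    congr 1
    exact τ.val_injective (by simp)
  -- By conjugate linearity (x - iy)^* = x^* + iy^*. Multiplying by -i, which preserves the norm,
  -- gives y^* - i x^*.
  have h3 : ‖τ.starXc y - Complex.I • τ.starXc x‖ = ‖x - Complex.I • y‖ := by
    rw [← τ.norm_starXc (x - Complex.I • y),
      ← one_mul ‖τ.starXc (x - Complex.I • y)‖, ← Complex.norm_I, ← norm_smul, ← norm_neg]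
    congr 1
    refine τ.val_injective ?_
    simp only [map_neg, map_sub, map_smul, val_starXc, star_sub, star_smul, Complex.star_def,
      Complex.conj_I, smul_sub, smul_smul, mul_neg, Complex.I_mul_I]
    module
  have h4 : ‖τ.starXc y + Complex.I • τ.starXc x‖ = ‖x + Complex.I • y‖ := by
    rw [← τ.norm_starXc (x + Complex.I • y),
      ← one_mul ‖τ.starXc (x + Complex.I • y)‖, ← Complex.norm_I, ← norm_smul]
    congr 1
    refine τ.val_injective ?_
    simp only [map_add, map_smul, val_starXc, star_add, star_smul, Complex.star_def,
      Complex.conj_I, smul_add, smul_smul, mul_neg, Complex.I_mul_I]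
    module
  rw [inner_eq_sum_norm_sq_div_four (𝕜 := ℂ), inner_eq_sum_norm_sq_div_four (𝕜 := ℂ) x y]
  simp only [RCLike.I_to_complex, h1, h2, h3, h4]

lemma inner_mulXc_left (x y z : τ.Xc) :
    inner ℂ (τ.mulXc x y) z = inner ℂ y (τ.mulXc (τ.starXc x) z) := by
  simp only [inner_def, val_mulXc, val_starXc, star_mul, mul_assoc]

lemma inner_mulXc_right (x y z : τ.Xc) :
    inner ℂ (τ.mulXc x y) z = inner ℂ x (τ.mulXc z (τ.starXc y)) := by
  rw [inner_mulXc_left, ← inner_starXc]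
  simp only [inner_def, val_mulXc, val_starXc, star_mul, star_star, mul_assoc]

/-- Conjugating by the isometric involution turns right multiplication by y into left multiplication
by y^*. -/
lemma norm_mulXc_le (x y : τ.Xc) : ‖τ.mulXc x y‖ ≤ ‖star (τ.val y)‖ * ‖x‖ := by
  rw [← norm_starXc, ← τ.norm_starXc x]
  refine le_trans (le_of_eq ?_)
    (τ.norm_ofAc_mul_le (star (τ.val y)) (star_mem_Ac G (τ.val_mem y)) (τ.starXc x))
  congr 1
  exact τ.val_injective (by simp)

/-- Right multiplication by `y ∈ X_c` on `L²(X, τ)`. -/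
noncomputable def rmul (y : τ.Xc) : τ.L2 →L[ℂ] τ.L2 :=
  (LinearMap.mkContinuous
    { toFun := fun x => τ.mulXc x y
      map_add' := fun a b => τ.val_injective (by simp [add_mul])
      map_smul' := fun c a => τ.val_injective (by simp [smul_mul_assoc]) }
    ‖star (τ.val y)‖ fun x => τ.norm_mulXc_le x y).completion

lemma rmul_coe (x y : τ.Xc) : τ.rmul y (x : τ.L2) = (τ.mulXc x y : τ.L2) := by
  simp [rmul]

lemma inner_rmul (x y : τ.Xc) (h : τ.L2) :
    inner ℂ (τ.rmul y h) (x : τ.L2) = inner ℂ h (τ.mulXc x (τ.starXc y) : τ.L2) := by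
  induction h using UniformSpace.Completion.induction_on with
  | hp => exact isClosed_eq (by fun_prop) (by fun_prop)
  | ih z =>
    rw [rmul_coe, UniformSpace.Completion.inner_coe, UniformSpace.Completion.inner_coe,
      inner_mulXc_right]

/-- The operator `z ↦ Φ(x^* z)` on `L²(X, τ)`. -/
noncomputable def coeff (x : τ.Xc) : τ.L2 →L[ℂ] τ.L2 :=
  (LinearMap.mkContinuous
    { toFun := fun z => τ.expectXc (τ.mulXc (τ.starXc x) z)
      map_add' := fun a b => by
        rw [← map_add]
        congr 1
        exact τ.val_injective (by simp [mul_add])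
      map_smul' := fun c a => by
        rw [← map_smul]
        congr 1
        exact τ.val_injective (by simp [mul_smul_comm]) }
    ‖star (τ.val x)‖ fun z => (τ.norm_expect_le _).trans
      (τ.norm_ofAc_mul_le _ (star_mem_Ac G (τ.val_mem x)) z)).completion

lemma coeff_coe (x z : τ.Xc) :
    τ.coeff x (z : τ.L2) = (τ.expectXc (τ.mulXc (τ.starXc x) z) : τ.L2) := by
  simp [coeff]

lemma expectXc_expectXc (x : τ.Xc) : τ.expectXc (τ.expectXc x) = τ.expectXc x :=
  τ.val_injective (expect_expect G (τ.val_mem x))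

/-- The adjoint of C_x sends z ∈ X_c to x Φ(z). -/
lemma inner_coeff (x z : τ.Xc) (h : τ.L2) :
    inner ℂ (z : τ.L2) (τ.coeff x h) = inner ℂ (τ.mulXc x (τ.expectXc z) : τ.L2) h := by
  induction h using UniformSpace.Completion.induction_on with
  | hp => exact isClosed_eq (by fun_prop) (by fun_prop)
  | ih w =>
    rw [coeff_coe, UniformSpace.Completion.inner_coe, UniformSpace.Completion.inner_coe,
      ← inner_expect, inner_mulXc_left]

/-- This is Θ_{x,x} = C_x^* C_x as a quadratic form; it gives positivity of Θ_{x,x} and turns the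
frame identity into a sum of squares. -/
lemma inner_theta_self (x : τ.Xc) (h : τ.L2) :
    inner ℂ h (τ.theta x x h) = ((‖τ.coeff x h‖ ^ 2 : ℝ) : ℂ) := by
  induction h using UniformSpace.Completion.induction_on with
  | hp => exact isClosed_eq (by fun_prop) (by fun_prop)
  | ih z =>
    have h1 : τ.thetaLin x x z = τ.mulXc x (τ.expectXc (τ.mulXc (τ.starXc x) z)) := rfl
    rw [theta_coe, h1, coeff_coe, UniformSpace.Completion.norm_coe,
      UniformSpace.Completion.inner_coe, ← inner_conj_symm, inner_mulXc_left, inner_conj_symm]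
    push_cast
    rw [← RCLike.ofReal_eq_complex_ofReal, ← inner_self_eq_norm_sq_to_K (𝕜 := ℂ), inner_expect,
      expectXc_expectXc]

/-! ### The von Neumann algebra and right multiplication -/

lemma theta_mem (x y : τ.Xc) : τ.theta x y ∈ τ.vonNeumann := by
  intro U hU
  exact (hU _ (Submodule.subset_span ⟨x, y, rfl⟩)).symm

/-- Each Θ_{x,y} is a right module map over Φ(X_c), since Φ is. Elements of N, being in the
bicommutant, inherit this. -/
lemma rmul_mem_centralizer (w : τ.Xc) : τ.rmul (τ.expectXc w) ∈
    Set.centralizer (τ.finiteRank : Set (τ.L2 →L[ℂ] τ.L2)) := by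
  intro T hT
  replace hT : T ∈ τ.finiteRank := hT
  induction hT using Submodule.span_induction with
  | mem T hT =>
    obtain ⟨x, y, rfl⟩ := hT
    refine ContinuousLinearMap.ext fun h => ?_
    induction h using UniformSpace.Completion.induction_on with
    | hp => exact isClosed_eq (by fun_prop) (by fun_prop)
    | ih z =>
      change τ.theta x y (τ.rmul (τ.expectXc w) z) = τ.rmul (τ.expectXc w) (τ.theta x y z)
      rw [rmul_coe, theta_coe, theta_coe, rmul_coe]
      congr 1
      refine τ.val_injective ?_
      simp only [val_thetaLin, val_mulXc, val_expectXc]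
      rw [← mul_assoc (star _), expect_mul_expect
        (mul_mem_Ac G (star_mem_Ac G (τ.val_mem y)) (τ.val_mem z)) (τ.val_mem w), mul_assoc]
  | zero => rw [zero_mul, mul_zero]
  | add x y _ _ hx hy => rw [add_mul, mul_add, hx, hy]
  | smul c x _ hx => rw [smul_mul_assoc, mul_smul_comm, hx]

lemma apply_rmul {T : τ.L2 →L[ℂ] τ.L2} (hT : T ∈ τ.vonNeumann) (w : τ.Xc) (h : τ.L2) :
    T (τ.rmul (τ.expectXc w) h) = τ.rmul (τ.expectXc w) (T h) :=
  (congrArg (fun U : τ.L2 →L[ℂ] τ.L2 => U h) (hT _ (τ.rmul_mem_centralizer w))).symm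

/-- Formally Φ(y^* T^* x) is the adjoint of Φ(x^* T y), but T y need not lie in X_c, so the identity
is tested against z ∈ X_c. There ⟨z, C_y T^* x⟩ = ⟨T(yΦ(z)), x⟩ = ⟨(T y)Φ(z), x⟩ = ⟨T y, xΦ(z)^*⟩,
which is conjugate to ⟨Φ(z)^*, C_x T y⟩, and ‖Φ(z)^*‖ ≤ ‖z‖. -/
lemma norm_coeff_adjoint_le {T : τ.L2 →L[ℂ] τ.L2} (hT : T ∈ τ.vonNeumann) (x y : τ.Xc) :
    ‖τ.coeff y (star T (x : τ.L2))‖ ≤ ‖τ.coeff x (T (y : τ.L2))‖ := by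
  have hz : ∀ z : τ.L2, ‖inner ℂ z (τ.coeff y (star T (x : τ.L2)))‖ ≤
      ‖z‖ * ‖τ.coeff x (T (y : τ.L2))‖ := by
    intro z
    induction z using UniformSpace.Completion.induction_on with
    | hp => exact isClosed_le (by fun_prop) (by fun_prop)
    | ih z =>
      have hs : τ.expectXc (τ.starXc (τ.expectXc z)) = τ.starXc (τ.expectXc z) := by
        refine τ.val_injective ?_
        simp only [val_expectXc, val_starXc]
        rw [expect_star (expect_mem_Ac G (τ.val_mem z)), expect_expect G (τ.val_mem z)]
      have h2 := τ.inner_coeff x (τ.starXc (τ.expectXc z)) (T (y : τ.L2))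
      rw [hs] at h2
      rw [inner_coeff, ContinuousLinearMap.star_eq_adjoint,
        ContinuousLinearMap.adjoint_inner_right, ← rmul_coe, τ.apply_rmul hT, inner_rmul,
        ← inner_conj_symm, ← h2, RCLike.norm_conj]
      refine (norm_inner_le_norm _ _).trans ?_
      rw [UniformSpace.Completion.norm_coe, UniformSpace.Completion.norm_coe, norm_starXc]
      gcongr
      exact τ.norm_expect_le z
  -- Testing against the vector itself turns the bound on the functional into a bound on the norm.
  have h1 := hz (τ.coeff y (star T (x : τ.L2)))
  rw [inner_self_eq_norm_sq_to_K, norm_pow, RCLike.norm_ofReal, abs_norm] at h1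
  by_contra! hlt
  have h0 := (norm_nonneg (τ.coeff x (T (y : τ.L2)))).trans_lt hlt
  nlinarith

/-- The matrix coefficients of `T ∈ N` and of `T^*` have the same norms. -/
lemma norm_coeff_adjoint {T : τ.L2 →L[ℂ] τ.L2} (hT : T ∈ τ.vonNeumann) (x y : τ.Xc) :
    ‖τ.coeff y (star T (x : τ.L2))‖ = ‖τ.coeff x (T (y : τ.L2))‖ := by
  refine le_antisymm (τ.norm_coeff_adjoint_le hT x y) ?_
  have := τ.norm_coeff_adjoint_le (star_mem hT) y x
  rwa [star_star] at this

/-! ### Parseval's identity -/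

/-- Pairing the frame identity ∑ᵢ Θ_{ξᵢ,ξᵢ} z = z with z proves this on X_c, and density does the
rest. -/
theorem hasSum_norm_coeff_frame (hfin : G.LocallyFinite) (hsrc : G.NoSources) (h : τ.L2) :
    HasSum (fun i => ‖τ.coeff (τ.frame i) h‖ ^ 2) (‖h‖ ^ 2) := by
  refine hasSum_norm_sq_of_dense (fun i => τ.coeff (τ.frame i)) (fun z => ?_) h
  have h1 := Complex.hasSum_re ((innerSL ℂ z).hasSum (τ.hasSum_thetaLin_frame hfin hsrc z))
  simp only [innerSL_apply_apply] at h1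
  rw [show (inner ℂ z z).re = ‖z‖ ^ 2 from inner_self_eq_norm_sq (𝕜 := ℂ) z] at h1
  convert h1 using 2 with i
  have h2 := congrArg Complex.re (τ.inner_theta_self (τ.frame i) z)
  rw [theta_coe, UniformSpace.Completion.inner_coe, Complex.ofReal_re] at h2
  exact h2.symm

lemma tsum_norm_coeff_frame (hfin : G.LocallyFinite) (hsrc : G.NoSources) (h : τ.L2) :
    ∑' i, ENNReal.ofReal (‖τ.coeff (τ.frame i) h‖ ^ 2) = ENNReal.ofReal (‖h‖ ^ 2) := by
  have hs := τ.hasSum_norm_coeff_frame hfin hsrc h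
  rw [← hs.tsum_eq, ENNReal.ofReal_tsum_of_nonneg (fun _ => by positivity) hs.summable]

/-- Parseval for T x, with each C_{ξᵢ} T x replaced by C_x T^* ξᵢ, which has the same norm.
Traciality, faithfulness and the values on Θ_{x,x} all come from this formula. -/
lemma tsum_norm_coeff_apply_frame (hfin : G.LocallyFinite) (hsrc : G.NoSources)
    {T : τ.L2 →L[ℂ] τ.L2} (hT : T ∈ τ.vonNeumann) (x : τ.Xc) :
    ∑' i, ENNReal.ofReal (‖τ.coeff x (star T (τ.frame i : τ.L2))‖ ^ 2) =
      ENNReal.ofReal (‖T (x : τ.L2)‖ ^ 2) := by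
  rw [← τ.tsum_norm_coeff_frame hfin hsrc]
  simp only [τ.norm_coeff_adjoint hT]

/-- `∑ᵢ ‖T ξᵢ‖² = ∑ᵢ ‖T^* ξᵢ‖²`. -/
theorem tsum_norm_apply_frame (hfin : G.LocallyFinite) (hsrc : G.NoSources)
    {T : τ.L2 →L[ℂ] τ.L2} (hT : T ∈ τ.vonNeumann) :
    ∑' i, ENNReal.ofReal (‖T (τ.frame i : τ.L2)‖ ^ 2) =
      ∑' i, ENNReal.ofReal (‖star T (τ.frame i : τ.L2)‖ ^ 2) := by
  -- Each ‖T ξᵢ‖² expands as ∑ⱼ ‖C_{ξᵢ} T^* ξⱼ‖². After interchanging the sums, Parseval in i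
  -- recovers ‖T^* ξⱼ‖².
  simp only [← τ.tsum_norm_coeff_apply_frame hfin hsrc hT]
  rw [ENNReal.tsum_comm]
  simp only [τ.tsum_norm_coeff_frame hfin hsrc]

end GaugeTrace
end RowFiniteGraph

/-! ### Square roots inside a von Neumann algebra. -/

section HilbertSpace

variable {H : Type*} [NormedAddCommGroup H] [InnerProductSpace ℂ H] [CompleteSpace H]

lemma inner_star_mul_self_apply (T : H →L[ℂ] H) (x : H) :
    (inner ℂ x ((star T * T) x)).re = ‖T x‖ ^ 2 := by
  rw [ContinuousLinearMap.star_eq_adjoint]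
  change (inner ℂ x (ContinuousLinearMap.adjoint T (T x))).re = _
  rw [ContinuousLinearMap.adjoint_inner_right]
  exact inner_self_eq_norm_sq (𝕜 := ℂ) _

/-- The square root commutes with everything that commutes with T, so it stays in the bicommutant.
-/
lemma VonNeumannAlgebra.exists_sqrt (M : VonNeumannAlgebra H) {T : H →L[ℂ] H} (hT : T ∈ M)
    (h0 : 0 ≤ T) : ∃ s ∈ M, star s = s ∧ s * s = T := by
  refine ⟨CFC.sqrt T, ?_, (IsSelfAdjoint.of_nonneg (CFC.sqrt_nonneg T)).star_eq,
    CFC.sqrt_mul_sqrt_self T h0⟩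
  rw [← M.commutant_commutant, VonNeumannAlgebra.mem_commutant_iff]
  intro U hU
  rw [VonNeumannAlgebra.mem_commutant_iff] at hU
  exact ((show Commute T U from hU T hT).cfcₙ_nnreal NNReal.sqrt).eq.symm

end HilbertSpace

/-! ### The functional τ̃: trace property, faithfulness, normality, semifiniteness. -/

namespace RowFiniteGraph

variable {V : Type u} {E : Type v} {G : RowFiniteGraph V E}

namespace GaugeTrace

open CStar IsTrace

variable (τ : G.GaugeTrace)

lemma omega_eq_frame (μ : G.FinPath) (T : τ.L2 →L[ℂ] τ.L2) :
    τ.omega μ T = inner ℂ (τ.frame (.inl μ) : τ.L2) (T (τ.frame (.inl μ))) +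
      inner ℂ (τ.frame (.inr μ) : τ.L2) (T (τ.frame (.inr μ))) := by
  rw [omega, frame, frame]
  split_ifs with h
  · rw [UniformSpace.Completion.coe_zero, inner_zero_left, add_zero]
  · rw [UniformSpace.Completion.coe_smul, map_smul, inner_smul_left, inner_smul_right, ← mul_assoc,
      Complex.conj_ofReal, ← Complex.ofReal_mul, ← sq, inv_pow, Real.sq_sqrt (Nat.cast_nonneg _)]
    simp

/-- `τ̃(T) = ∑ᵢ ⟨ξᵢ, T ξᵢ⟩`. -/
lemma tilde_eq_tsum (T : PosCone τ.vonNeumann.toStarSubalgebra) :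
    τ.tilde T =
      ∑' i, ENNReal.ofReal (inner ℂ (τ.frame i : τ.L2) (T.1.1 (τ.frame i : τ.L2))).re := by
  have hT : 0 ≤ T.1.1 := T.2
  rw [Summable.tsum_sum ENNReal.summable ENNReal.summable, ← ENNReal.tsum_add, tilde]
  refine tsum_congr fun μ => ?_
  rw [omega_eq_frame, Complex.add_re, ENNReal.ofReal_add (inner_re_apply_nonneg hT _)
    (inner_re_apply_nonneg hT _)]

lemma tilde_star_mul_self {X : τ.L2 →L[ℂ] τ.L2} {T : PosCone τ.vonNeumann.toStarSubalgebra}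
    (h : T.1.1 = star X * X) :
    τ.tilde T = ∑' i, ENNReal.ofReal (‖X (τ.frame i : τ.L2)‖ ^ 2) := by
  rw [tilde_eq_tsum, h]
  simp only [inner_star_mul_self_apply]

theorem isTrace_tilde (hfin : G.LocallyFinite) (hsrc : G.NoSources) : IsTrace τ.tilde where
  additive a b c h := by
    have ha : 0 ≤ a.1.1 := a.2
    have hb : 0 ≤ b.1.1 := b.2
    have hc : c.1.1 = a.1.1 + b.1.1 := congrArg Subtype.val h
    rw [tilde_eq_tsum, tilde_eq_tsum, tilde_eq_tsum, ← ENNReal.tsum_add, hc]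
    refine tsum_congr fun i => ?_
    rw [add_apply, inner_add_right, Complex.add_re,
      ENNReal.ofReal_add (inner_re_apply_nonneg ha _) (inner_re_apply_nonneg hb _)]
  homogeneous r a c h := by
    have hc : c.1.1 = ((r : ℝ) : ℂ) • a.1.1 := congrArg Subtype.val h
    rw [tilde_eq_tsum, tilde_eq_tsum, ← ENNReal.tsum_mul_left, hc]
    refine tsum_congr fun i => ?_
    rw [smul_apply, inner_smul_right, Complex.re_ofReal_mul, ENNReal.ofReal_mul r.coe_nonneg,
      ENNReal.ofReal_coe_nnreal]
  tracial x a b ha hb := by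
    have ha' : a.1.1 = star x.1 * x.1 := congrArg Subtype.val ha
    have hb' : b.1.1 = star (star x.1) * star x.1 := by
      rw [star_star]; exact congrArg Subtype.val hb
    rw [τ.tilde_star_mul_self ha', τ.tilde_star_mul_self hb',
      τ.tsum_norm_apply_frame hfin hsrc x.2]

theorem isFaithfulWeight_tilde (hfin : G.LocallyFinite) (hsrc : G.NoSources) :
    IsFaithfulWeight τ.tilde := by
  intro T hT
  obtain ⟨s, hs, hss, hsq⟩ := τ.vonNeumann.exists_sqrt (T := T.1.1) T.1.2 T.2
  rw [τ.tilde_star_mul_self (X := s) (by rw [hss, hsq]), ENNReal.tsum_eq_zero] at hT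
  have hz : ∀ i, star s (τ.frame i : τ.L2) = 0 := fun i => by
    have := hT i
    rw [ENNReal.ofReal_eq_zero] at this
    rw [hss]
    simpa using this
  -- As s^* kills the frame, ‖s x‖² = ∑ᵢ ‖C_x s^* ξᵢ‖² = 0 for x ∈ X_c.
  have hs0 : s = 0 := by
    refine ContinuousLinearMap.ext fun h => ?_
    induction h using UniformSpace.Completion.induction_on with
    | hp => exact isClosed_eq (by fun_prop) (by fun_prop)
    | ih x =>
      have := τ.tsum_norm_coeff_apply_frame hfin hsrc hs x
      simp only [hz, map_zero, norm_zero, ne_eq, OfNat.ofNat_ne_zero, not_false_eq_true, zero_pow,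
        ENNReal.ofReal_zero, tsum_zero] at this
      have := ENNReal.ofReal_eq_zero.1 this.symm
      simpa using this
  exact Subtype.ext (by rw [← hsq, hs0, zero_mul]; rfl)

theorem isNormalWeight_tilde : IsNormalWeight τ.vonNeumann τ.tilde := by
  intro D T hne hD hT
  have hne' : Nonempty D := hne.to_subtype
  have hsup : ∀ x : τ.L2, ENNReal.ofReal (inner ℂ x (T.1.1 x)).re =
      ⨆ R : D, ENNReal.ofReal (inner ℂ x (R.1.1.1 x)).re := by
    intro x
    have hlub := τ.vonNeumann.inner_isLUB D T hne hD hT x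
    refine le_antisymm ?_ (iSup_le fun R => ENNReal.ofReal_le_ofReal (hlub.1 ⟨R, R.2, rfl⟩))
    by_cases htop : ⨆ R : D, ENNReal.ofReal (inner ℂ x (R.1.1.1 x)).re = ⊤
    · rw [htop]; exact le_top
    · rw [ENNReal.ofReal_le_iff_le_toReal htop]
      refine hlub.2 ?_
      rintro _ ⟨R, hR, rfl⟩
      rw [← ENNReal.ofReal_le_iff_le_toReal htop]
      exact le_iSup (fun R : D => ENNReal.ofReal (inner ℂ x (R.1.1.1 x)).re) ⟨R, hR⟩
  rw [iSup_subtype', tilde_eq_tsum]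
  -- The infinite sum is a supremum of finite sums, and suprema commute with each other. Only a
  -- finite sum of suprema remains to be handled, and directedness of D provides the common upper
  -- bounds.
  simp only [tilde_eq_tsum, hsup, ENNReal.tsum_eq_iSup_sum]
  rw [iSup_comm]
  refine iSup_congr fun s => ?_
  refine ENNReal.finsetSum_iSup fun a b => ?_
  obtain ⟨c, hc, hac, hbc⟩ := hD a a.2 b b.2
  exact ⟨⟨c, hc⟩, fun i => ⟨ENNReal.ofReal_le_ofReal (inner_re_le_of_le hac _),
    ENNReal.ofReal_le_ofReal (inner_re_le_of_le hbc _)⟩⟩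

lemma theta_self_nonneg (x : τ.Xc) : 0 ≤ τ.theta x x := by
  have := le_of_inner_re_le (S := 0) (T := τ.theta x x) (IsSelfAdjoint.zero _) (τ.star_theta x x)
    fun h => by
      rw [inner_theta_self, Complex.ofReal_re]
      simp
  exact this

/-- The positive element `Θ_{x,x}` of `N`. -/
noncomputable def thetaPos (x : τ.Xc) : PosCone τ.vonNeumann.toStarSubalgebra :=
  ⟨⟨τ.theta x x, τ.theta_mem x x⟩, τ.theta_self_nonneg x⟩

/-- The case T = 1 of `tsum_norm_coeff_apply_frame`: ∑ᵢ ‖C_x ξᵢ‖² = ‖x‖². -/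
lemma tilde_thetaPos (hfin : G.LocallyFinite) (hsrc : G.NoSources) (x : τ.Xc) :
    τ.tilde (τ.thetaPos x) = ENNReal.ofReal (‖x‖ ^ 2) := by
  have h := τ.tsum_norm_coeff_apply_frame hfin hsrc (one_mem τ.vonNeumann) x
  simp only [star_one, one_apply_eq_self, UniformSpace.Completion.norm_coe] at h
  rw [tilde_eq_tsum, ← h]
  refine tsum_congr fun i => ?_
  exact congrArg (fun c : ℂ => ENNReal.ofReal c.re) (τ.inner_theta_self x _)

theorem isSemifiniteWeight_tilde (hfin : G.LocallyFinite) (hsrc : G.NoSources) :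
    IsSemifiniteWeight τ.vonNeumann τ.tilde := by
  intro T hT
  obtain ⟨s, hs, hss, hsq⟩ := τ.vonNeumann.exists_sqrt (T := T.1.1) T.1.2 T.2
  -- If every Θ_{ξᵢ,ξᵢ} s vanished, all frame coefficients of s h would be zero, and Parseval would
  -- give s = 0.
  obtain ⟨i, hi⟩ : ∃ i, τ.theta (τ.frame i) (τ.frame i) * s ≠ 0 := by
    by_contra! hall
    refine hT (Subtype.ext ?_)
    rw [← hsq]
    suffices s = 0 by rw [this, zero_mul]; rfl
    refine ContinuousLinearMap.ext fun h => ?_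
    have h1 := τ.hasSum_norm_coeff_frame hfin hsrc (s h)
    have h2 : ∀ i, ‖τ.coeff (τ.frame i) (s h)‖ ^ 2 = 0 := fun i => by
      have := τ.inner_theta_self (τ.frame i) (s h)
      have h0 : τ.theta (τ.frame i) (τ.frame i) (s h) = 0 :=
        congrArg (fun W : τ.L2 →L[ℂ] τ.L2 => W h) (hall i)
      rw [h0, inner_zero_right] at this
      exact_mod_cast this.symm
    simp only [h2] at h1
    simpa using h1.unique hasSum_zero
  set P := τ.theta (τ.frame i) (τ.frame i) with hP
  have hPM : P ∈ τ.vonNeumann := τ.theta_mem _ _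
  have hPs : star P = P := τ.star_theta _ _
  have hP0 : 0 ≤ P := τ.theta_self_nonneg _
  -- ⟨h, P h⟩ is a single term of the Parseval sum for ‖h‖².
  have hP1 : P ≤ 1 := by
    refine le_of_inner_re_le hPs (IsSelfAdjoint.one _) fun h => ?_
    rw [hP, inner_theta_self, Complex.ofReal_re, one_apply_eq_self]
    refine (le_hasSum (τ.hasSum_norm_coeff_frame hfin hsrc h) i
      fun _ _ => by positivity).trans_eq ?_
    exact (inner_self_eq_norm_sq (𝕜 := ℂ) h).symm
  have hPn : ‖P‖ ≤ 1 := (CStarAlgebra.norm_le_one_iff_of_nonneg P hP0).2 hP1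
  have hXM : P * s ∈ τ.vonNeumann := mul_mem hPM hs
  let R : PosCone τ.vonNeumann.toStarSubalgebra :=
    ⟨⟨star (P * s) * (P * s), mul_mem (star_mem hXM) hXM⟩, star_mul_self_nonneg (P * s)⟩
  refine ⟨R, ?_, ?_, ?_⟩
  · change star (P * s) * (P * s) ≤ T.1.1
    refine le_of_inner_re_le (IsSelfAdjoint.star_mul_self _)
      (IsSelfAdjoint.of_nonneg (show 0 ≤ T.1.1 from T.2)) fun h => ?_
    rw [← hsq]
    nth_rewrite 3 [← hss]
    rw [inner_star_mul_self_apply, inner_star_mul_self_apply]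
    gcongr
    exact (P.le_of_opNorm_le hPn (s h)).trans_eq (one_mul _)
  · intro h
    exact hi ((CStarRing.star_mul_self_eq_zero_iff _).1 (congrArg Subtype.val h))
  · have h1 : τ.tilde R = ∑' j, ENNReal.ofReal (‖(P * s) (τ.frame j : τ.L2)‖ ^ 2) :=
      τ.tilde_star_mul_self rfl
    -- The trace property replaces P s by s P = (s r) r with r = √P. This leaves the factor ‖s r‖²
    -- times ∑ⱼ ‖r ξⱼ‖² = τ̃(P), which is finite.
    rw [h1, τ.tsum_norm_apply_frame hfin hsrc hXM, star_mul, hss, hPs]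
    obtain ⟨r, hr, hrs, hrq⟩ := τ.vonNeumann.exists_sqrt hPM hP0
    have h2 : τ.tilde (τ.thetaPos (τ.frame i)) =
        ∑' j, ENNReal.ofReal (‖r (τ.frame j : τ.L2)‖ ^ 2) :=
      τ.tilde_star_mul_self (by rw [hrs, hrq]; rfl)
    have hle : ∑' j, ENNReal.ofReal (‖(s * P) (τ.frame j : τ.L2)‖ ^ 2) ≤
        ENNReal.ofReal (‖s * r‖ ^ 2) * τ.tilde (τ.thetaPos (τ.frame i)) := by
      rw [h2, ← ENNReal.tsum_mul_left]
      refine ENNReal.tsum_le_tsum fun j => ?_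
      rw [← ENNReal.ofReal_mul (by positivity), ← mul_pow, ← hrq, ← mul_assoc]
      gcongr
      exact (s * r).le_opNorm _
    refine hle.trans_lt (ENNReal.mul_lt_top ENNReal.ofReal_lt_top ?_)
    rw [τ.tilde_thetaPos hfin hsrc]
    exact ENNReal.ofReal_lt_top

/-! ### Finite rank operators -/

lemma tilde_thetaPos_lt_top (hfin : G.LocallyFinite) (hsrc : G.NoSources) (x : τ.Xc) :
    τ.tilde (τ.thetaPos x) < ⊤ := by
  rw [τ.tilde_thetaPos hfin hsrc]
  exact ENNReal.ofReal_lt_top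

lemma toReal_tilde_thetaPos (hfin : G.LocallyFinite) (hsrc : G.NoSources) (x : τ.Xc) :
    (τ.tilde (τ.thetaPos x)).toReal = ‖x‖ ^ 2 := by
  rw [τ.tilde_thetaPos hfin hsrc, ENNReal.toReal_ofReal (by positivity)]

lemma theta_add_left (x x' y : τ.Xc) : τ.theta (x + x') y = τ.theta x y + τ.theta x' y := by
  refine ContinuousLinearMap.ext fun h => ?_
  induction h using UniformSpace.Completion.induction_on with
  | hp => exact isClosed_eq (by fun_prop) (by fun_prop)
  | ih z =>
    rw [add_apply, theta_coe, theta_coe, theta_coe, ← UniformSpace.Completion.coe_add]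
    congr 1
    exact τ.val_injective (by simp only [val_thetaLin, map_add, add_mul])

lemma theta_smul_left (c : ℂ) (x y : τ.Xc) : τ.theta (c • x) y = c • τ.theta x y := by
  refine ContinuousLinearMap.ext fun h => ?_
  induction h using UniformSpace.Completion.induction_on with
  | hp => exact isClosed_eq (τ.theta (c • x) y).continuous (c • τ.theta x y).continuous
  | ih z =>
    rw [smul_apply, theta_coe, theta_coe, ← UniformSpace.Completion.coe_smul]
    congr 1
    exact τ.val_injective (by simp only [val_thetaLin, map_smul, smul_mul_assoc])

lemma theta_add_right (x y y' : τ.Xc) : τ.theta x (y + y') = τ.theta x y + τ.theta x y' := by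
  rw [← star_theta, theta_add_left, star_add, star_theta, star_theta]

lemma theta_smul_right (c : ℂ) (x y : τ.Xc) : τ.theta x (c • y) = star c • τ.theta x y := by
  rw [← star_theta, theta_smul_left, star_smul, star_theta]

/-- The usual factor 1/4 is absorbed into the vectors as 1/2, so that the four terms are of the form
Θ_{u,u} and fit `HasWeightValue` directly. The scalar identity `inner_polarization` uses the same
four vectors. -/
lemma theta_polarization (x y : τ.Xc) :
    τ.theta x y =
      (τ.theta ((1 / 2 : ℂ) • (x + y)) ((1 / 2 : ℂ) • (x + y)) -
        τ.theta ((1 / 2 : ℂ) • (x + (-1 : ℂ) • y)) ((1 / 2 : ℂ) • (x + (-1 : ℂ) • y))) +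
      Complex.I • (τ.theta ((1 / 2 : ℂ) • (x + Complex.I • y)) ((1 / 2 : ℂ) • (x + Complex.I • y)) -
        τ.theta ((1 / 2 : ℂ) • (x + (-Complex.I) • y)) ((1 / 2 : ℂ) • (x + (-Complex.I) • y))) := by
  simp only [theta_add_left, theta_add_right, theta_smul_left, theta_smul_right, Complex.star_def,
    map_neg, map_one, map_div₀, Complex.conj_I, Complex.conj_ofNat]
  match_scalars <;> ring_nf <;> simp only [Complex.I_sq] <;> ring

lemma inner_polarization (x y : τ.Xc) :
    inner ℂ y x =
      ((‖(1 / 2 : ℂ) • (x + y)‖ ^ 2 - ‖(1 / 2 : ℂ) • (x + (-1 : ℂ) • y)‖ ^ 2 : ℝ) : ℂ) +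
      Complex.I * ((‖(1 / 2 : ℂ) • (x + Complex.I • y)‖ ^ 2 -
        ‖(1 / 2 : ℂ) • (x + (-Complex.I) • y)‖ ^ 2 : ℝ) : ℂ) := by
  have h : ∀ z : τ.Xc, ((‖z‖ : ℝ) : ℂ) ^ 2 = inner ℂ z z := fun z =>
    (inner_self_eq_norm_sq_to_K (𝕜 := ℂ) z).symm
  push_cast
  simp only [h, inner_add_left, inner_add_right, inner_smul_left, inner_smul_right, map_neg,
    map_one, map_div₀, Complex.conj_I, Complex.conj_ofNat]
  ring_nf
  simp only [Complex.I_sq]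
  ring

lemma hasWeightValue_theta (hfin : G.LocallyFinite) (hsrc : G.NoSources) (x y : τ.Xc) :
    HasWeightValue τ.tilde (⟨τ.theta x y, τ.theta_mem x y⟩ : τ.vonNeumann.toStarSubalgebra)
      (inner ℂ (y : τ.L2) (x : τ.L2)) := by
  have h := τ.tilde_thetaPos_lt_top hfin hsrc
  refine ⟨_, _, _, _, h ((1 / 2 : ℂ) • (x + y)), h ((1 / 2 : ℂ) • (x + (-1 : ℂ) • y)),
    h ((1 / 2 : ℂ) • (x + Complex.I • y)), h ((1 / 2 : ℂ) • (x + (-Complex.I) • y)),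
    Subtype.ext (τ.theta_polarization x y), ?_⟩
  simp only [τ.toReal_tilde_thetaPos hfin hsrc]
  rw [UniformSpace.Completion.inner_coe]
  exact τ.inner_polarization x y

lemma mem_weightDomain_of_hasWeightValue {A : Type*} [NonUnitalRing A] [StarRing A] [Module ℂ A]
    [PartialOrder A] {φ : PosCone A → ℝ≥0∞} {a : A} {c : ℂ} (h : HasWeightValue φ a c) :
    a ∈ weightDomain φ := by
  obtain ⟨a₀, a₁, a₂, a₃, h0, h1, h2, h3, rfl, _⟩ := h
  have hm : ∀ b : PosCone A, φ b < ⊤ → (b : A) ∈ weightDomain φ :=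
    fun b hb => Submodule.subset_span ⟨b.2, hb⟩
  exact add_mem (sub_mem (hm _ h0) (hm _ h1))
    (Submodule.smul_mem _ _ (sub_mem (hm _ h2) (hm _ h3)))

theorem finiteRank_mem_weightDomain (hfin : G.LocallyFinite) (hsrc : G.NoSources)
    {T : τ.L2 →L[ℂ] τ.L2} (hT : T ∈ τ.finiteRank) :
    ∃ hT : T ∈ τ.vonNeumann.toStarSubalgebra,
      (⟨T, hT⟩ : τ.vonNeumann.toStarSubalgebra) ∈ weightDomain τ.tilde := by
  induction hT using Submodule.span_induction with
  | mem T hT =>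
    obtain ⟨x, y, rfl⟩ := hT
    exact ⟨τ.theta_mem x y,
      mem_weightDomain_of_hasWeightValue (τ.hasWeightValue_theta hfin hsrc x y)⟩
  | zero => exact ⟨zero_mem _, zero_mem (weightDomain τ.tilde)⟩
  | add x y _ _ hx hy =>
    obtain ⟨hx, hx'⟩ := hx
    obtain ⟨hy, hy'⟩ := hy
    exact ⟨add_mem hx hy, add_mem hx' hy'⟩
  | smul c x _ hx =>
    obtain ⟨hx, hx'⟩ := hx
    exact ⟨SMulMemClass.smul_mem c hx, Submodule.smul_mem _ c hx'⟩

/-- Uniqueness of the extended value requires N to be a C⋆-algebra with its star order. N is norm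
closed as a centralizer, and the order inherited from the bounded operators is the right one because
a positive element of N has its square root in N. -/
lemma weightExt_tilde_eq (hfin : G.LocallyFinite) (hsrc : G.NoSources)
    {a : τ.vonNeumann.toStarSubalgebra} {c : ℂ} (h : HasWeightValue τ.tilde a c) :
    weightExt τ.tilde a = c := by
  have hcl : IsClosed (τ.vonNeumann.toStarSubalgebra : Set (τ.L2 →L[ℂ] τ.L2)) :=
    Set.isClosed_centralizer _
  let _ : NonUnitalCStarAlgebra τ.vonNeumann.toStarSubalgebra :=
    (StarSubalgebra.cstarAlgebra τ.vonNeumann.toStarSubalgebra (h_closed := hcl)).toNonUnitalCStarAlgebra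
  have : StarOrderedRing τ.vonNeumann.toStarSubalgebra :=
    StarOrderedRing.of_nonneg_iff' (fun {x y} hxy z => add_le_add_right (α := τ.L2 →L[ℂ] τ.L2) hxy z.1)
      fun x => by
      constructor
      · intro hx
        obtain ⟨s, hs, hss, hsq⟩ := τ.vonNeumann.exists_sqrt (T := x.1) x.2 hx
        exact ⟨⟨s, hs⟩, Subtype.ext (by rw [← hsq]; nth_rewrite 1 [← hss]; rfl)⟩
      · rintro ⟨s, rfl⟩
        exact star_mul_self_nonneg s.1
  exact (τ.isTrace_tilde hfin hsrc).weightExt_eq h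

end GaugeTrace
end RowFiniteGraph

/-- For a countable, locally finite directed graph `G` without sources and a faithful, semifinite, norm
lower-semicontinuous, gauge invariant trace `τ` on `C^*(G)`, the functional `τ̃` is a faithful normal
semifinite trace on `N = (End^{00}_F(X_c))''`, its domain of definition contains `End^{00}_F(X_c)`, and
`τ̃(Θ_{x,y}) = ⟨y, x⟩ = τ(y^* x)`. -/
theorem proposition5p7 {V E : Type*} [Countable V] [Countable E]
    (G : RowFiniteGraph V E) (hfin : G.LocallyFinite) (hsrc : G.NoSources) (τ : G.GaugeTrace) :
    IsTrace τ.tilde ∧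
    IsFaithfulWeight τ.tilde ∧
    IsNormalWeight τ.vonNeumann τ.tilde ∧
    IsSemifiniteWeight τ.vonNeumann τ.tilde ∧
    (∀ T ∈ τ.finiteRank, ∃ hT : T ∈ τ.vonNeumann.toStarSubalgebra,
      (⟨T, hT⟩ : τ.vonNeumann.toStarSubalgebra) ∈ weightDomain τ.tilde) ∧
    (∀ x y : τ.Xc, ∃ hT : τ.theta x y ∈ τ.vonNeumann.toStarSubalgebra,
      weightExt τ.tilde ⟨τ.theta x y, hT⟩ = inner ℂ (y : τ.L2) (x : τ.L2) ∧
      inner ℂ (y : τ.L2) (x : τ.L2) = τ.ext (star (τ.val y) * τ.val x)) :=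
  ⟨τ.isTrace_tilde hfin hsrc, τ.isFaithfulWeight_tilde hfin hsrc, τ.isNormalWeight_tilde,
    τ.isSemifiniteWeight_tilde hfin hsrc, fun _ hT => τ.finiteRank_mem_weightDomain hfin hsrc hT,
    fun x y => ⟨τ.theta_mem x y,
      τ.weightExt_tilde_eq hfin hsrc (τ.hasWeightValue_theta hfin hsrc x y),
      UniformSpace.Completion.inner_coe y x⟩⟩
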